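/- **Setting.** There are $n\ge 1$ players with $k\ge 1$ actions each. A player $i$ of type $t$ receives the payoff $u_i(t,\mathbf a)\in[0,1]$ when the action profile $\mathbf a\in[k]^n$ is played. The game is *$\lambda$-large* ($\lambda>0$): for $i\ne i'$, a change of the action of player $i$ changes $u_{i'}(t,\mathbf a)$ by at most $\lambda$, for every type $t$. For a type profile $\tau$ put $v_i=u_i(\tau_i,\cdot)$. A distribution $\pi$ on $[k]^n$ is an *$\eta$-approximate correlated equilibrium* if $\mathbb E_{\mathbf a\sim\pi}[v_i(\mathbf a)]\ge \mathbb E_{\mathbf a\sim\pi}[v_i(f(a_i),\mathbf a_{-i})]-\eta$ for every player $i$ and every $f:[k]\to[k]$. An *online learning algorithm* is a measurable map $\mathcal A:\Pi\times\mathbb R^k\to\Pi$, where $\Pi$ is the set of distributions on $[k]$. On a loss sequence $l_1,l_2,\dots\in\mathbb R^k$ it plays $\pi_1=$ uniform and $\pi_{t+1}=\mathcal A(\pi_t,l_t)$. Its *swap regret over $T$ rounds* is $\max_{f:[k]\to[k]}\frac1T\sum_{t=1}^T\sum_j\big(\pi_t^j-(f\circ\pi_t)^j\big)l_t^j$, where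 $f\circ\pi_t$ is the law of $f(j)$ for $j\sim\pi_t$. It is *at most $R$* if this holds for all loss sequences in $[0,1]^k$ (for deterministic $\mathcal A$ this is the same as for all adaptively chosen losses). For $\varepsilon>0$, $\delta\in(0,1)$, $T\ge 1$ let $b=\lambda\varepsilon^{-1}\sqrt{8nkT\log(1/\delta)}$. The algorithm $\texttt{NR-LAPLACE}^{\mathcal A}$ starts with $\pi_{i,1}$ uniform for every player $i$; in round $t=1,\dots,T$ it computes the losses $l_{i,t}^j=1-\mathbb E_{\mathbf a_{-i}\sim\pi_{-i,t}}[v_i(j,\mathbf a_{-i})]$ (product distribution), adds independent Laplace noise $z_{i,t}^j\sim\mathrm{Lap}(b)$, and sets $\pi_{i,t+1}=\mathcal A(\pi_{i,t},\,l_{i,t}+z_{i,t})$. It returns the average distribution of play: draw $t\in\{1,\dots,T\}$ uniformly, then $a_i\sim\pi_{i,t}$ independently. So that noisy losses stay in $[0,1]$, it is run with $\mathcal A'(\pi,l)=\mathcal A(\pi,(l+1)/3)$, the algorithm $\mathcal A$ on losses rescaled to $[1/3,2/3]$. Consider the condition $$\lambda\varepsilon^{-1}\sqrt{8nkT\log(1/\delta)}\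 \le\ \frac1{6\log(4nkT/\beta)}\qquad(\ast)$$ and write $g=\dfrac{\lambda k\sqrt{n\log(1/\delta)\log(1/\beta)}}{\varepsilon}$. **Theorem (Computing CE).** There are universal constants $C>0$ and $r\in\mathbb N$ such that the following holds for all $n,k\ge1$, $\lambda,\varepsilon>0$, $\delta\in(0,1)$, $\beta\in(0,1/2]$. 1. Let $T\ge1$ satisfy $(\ast)$ and let $\mathcal A$ have swap regret at most $R$ over $T$ rounds. Then for every $\lambda$-large game with payoffs in $[0,1]$ and every type profile, with probability at least $1-\beta$, $\texttt{NR-LAPLACE}^{\mathcal A'}$ run for $T$ rounds returns an $\eta$-approximate correlated equilibrium for $\eta=3R+C\,g\,\log^r(4nkT/\beta)$. 2. There are online learning algorithms $\mathcal A_{\mathsf{swap}}=\mathcal A_{\mathsf{swap}}^{k,T}$, depending only on $k$ and $T$, with swap regret at most $k\sqrt{2\log k/T}$ over $T$ rounds, such that the following holds. If some $T\ge1$ satisfies $(\ast)$, then one can select a $T\ge 1$ satisfying $(\ast)$, depending only on $n,k,\lambda,\varepsilon,\delta,\beta$, such that for every $\lambda$-large game with payoffs in $[0,1]$ and every type profile,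 with probability at least $1-\beta$, $\texttt{NR-LAPLACE}^{\mathcal A'_{\mathsf{swap}}}$ run for $T$ rounds returns an $\eta$-approximate correlated equilibrium for $$\eta= C\,g\,\big(\log(4nk/\beta)+|\log g|\big)^r=\tilde O\!\left(\frac{\lambda k\sqrt{n\log(1/\delta)\log(1/\beta)}}{\varepsilon}\right).$$ (The constants $C,r$ are common to both parts; the algorithms $\mathcal A_{\mathsf{swap}}$ in part 2 do not depend on $n,\lambda,\varepsilon,\delta,\beta$ or the game.) -/

import Mathlib

open MeasureTheory

noncomputable section

namespace NRLaplace

/-! ### Games -/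

/-- An action profile: one of `k` actions for each of the `n` players. -/
abbrev Profile (n k : ℕ) := Fin n → Fin k

/-- The distributions over the `k` actions. -/
abbrev Mixed (k : ℕ) := stdSimplex ℝ (Fin k)

/-- `u i t a` is the payoff of player `i` when her type is `t` and the profile `a` is played.
The game is `lam`-large if changing the action of one player changes the payoff of every other
player, whatever her type, by at most `lam`. -/
def IsLarge {n k : ℕ} {𝒯 : Fin n → Type*}
    (u : (i : Fin n) → 𝒯 i → Profile n k → ℝ) (lam : ℝ) :
    Prop :=
  ∀ i i' : Fin n, i ≠ i' → ∀ (t : 𝒯 i') (a : Profile n k) (x y : Fin k),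
    |u i' t (Function.update a i x) - u i' t (Function.update a i y)| ≤ lam

/-- The distribution with weights `w` on action profiles is an `η`-approximate correlated
equilibrium of the complete-information game with utility functions `v i`: no player gains more
than `η` in expectation by applying a function `f` to the action drawn for her. -/
def IsApproxCE {n k : ℕ} (v : Fin n → Profile n k → ℝ) (w : Profile n k → ℝ) (η : ℝ) : Prop :=
  ∀ (i : Fin n) (f : Fin k → Fin k),
    ∑ a, w a * v i a ≥ ∑ a, w a * v i (Function.update a i (f (a i))) - η

/-- The average distribution of play: draw one of the `T` rounds uniformly, then draw the action
of every player independently from her mixed strategy of that round. -/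
def averagePlay {n k : ℕ} (T : ℕ) (p : ℕ → Fin n → Mixed k) (a : Profile n k) : ℝ :=
  (1 / (T : ℝ)) * ∑ t ∈ Finset.range T, ∏ i, p t i (a i)

theorem averagePlay_mem_stdSimplex {n k T : ℕ} (hT : 1 ≤ T) (p : ℕ → Fin n → Mixed k) :
    averagePlay T p ∈ stdSimplex ℝ (Profile n k) := by
  have hT' : (T : ℝ) ≠ 0 := by positivity
  refine ⟨fun a => mul_nonneg (by positivity) (Finset.sum_nonneg fun t _ =>
    Finset.prod_nonneg fun i _ => (p t i).2.1 _), ?_⟩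
  have h : ∀ t, ∑ a : Profile n k, ∏ i, p t i (a i) = 1 := fun t => by
    rw [← Fintype.prod_sum (fun i j => p t i j)]
    exact Finset.prod_eq_one fun i _ => (p t i).2.2
  simp only [averagePlay]
  rw [← Finset.mul_sum, Finset.sum_comm, Finset.sum_congr rfl (fun t _ => h t)]
  simp [hT']

/-! ### Online learning

Rounds are indexed from `0`: round `t` here is round `t + 1` when rounds are counted from `1`. -/

/-- An online learning algorithm turns the current distribution and a vector of losses into the
next distribution. The losses may be arbitrary reals, as noise may push them out of `[0, 1]`. -/
abbrev OnlineAlgorithm (k : ℕ) := Mixed k → (Fin k → ℝ) → Mixed k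

/-- The distributions played on the loss sequence `L`: the first one is uniform, and the one for
round `t + 1` is computed after the losses of round `t` have been seen. -/
def OnlineAlgorithm.run {k : ℕ} [NeZero k] (A : OnlineAlgorithm k) (L : ℕ → Fin k → ℝ) :
    ℕ → Mixed k
  | 0 => stdSimplex.barycenter
  | t + 1 => A (A.run L t) (L t)

/-- Average expected loss over the first `T` rounds. -/
def averageLoss {k : ℕ} (T : ℕ) (p : ℕ → Mixed k) (L : ℕ → Fin k → ℝ) : ℝ :=
  (1 / (T : ℝ)) * ∑ t ∈ Finset.range T, ∑ j, p t j * L t j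

/-- Average regret of the sequence of distributions `p` to the modification rule `f`;
`stdSimplex.map f (p t)` is the law of `f j` for `j` drawn from `p t`. -/
def regret {k : ℕ} (T : ℕ) (p : ℕ → Mixed k) (L : ℕ → Fin k → ℝ) (f : Fin k → Fin k) : ℝ :=
  averageLoss T p L - averageLoss T (fun t => stdSimplex.map f (p t)) L

/-- Swap regret: the largest regret over all functions from actions to actions. -/
def swapRegret {k : ℕ} (T : ℕ) (p : ℕ → Mixed k) (L : ℕ → Fin k → ℝ) : ℝ :=
  Finset.univ.sup' ⟨id, Finset.mem_univ _⟩ fun f : Fin k → Fin k => regret T p L f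

/-- Over `T` rounds, the swap regret of `A` is at most `R` against every sequence of losses in
`[0, 1]`. As `A` is deterministic, a loss that is adapted to the past losses and distributions
produces one such sequence, and every such sequence arises in this way. -/
def HasSwapRegretAtMost {k : ℕ} [NeZero k] (A : OnlineAlgorithm k) (T : ℕ) (R : ℝ) : Prop :=
  ∀ L : ℕ → Fin k → ℝ, (∀ t j, L t j ∈ Set.Icc (0 : ℝ) 1) → swapRegret T (A.run L) L ≤ R

/-- The algorithm that feeds `A` with the losses `(l + 1) / 3` in place of `l`. Losses in `[0, 1]`
become losses in `[1/3, 2/3]`, which leaves room for noise. -/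
def OnlineAlgorithm.rescaled {k : ℕ} (A : OnlineAlgorithm k) : OnlineAlgorithm k :=
  fun p l => A p fun j => (l j + 1) / 3

/-! ### The algorithm -/

/-- The Laplace distribution with parameter `b > 0`. -/
def laplaceMeasure (b : ℝ) : Measure ℝ :=
  volume.withDensity fun z => ENNReal.ofReal (1 / (2 * b) * Real.exp (-|z| / b))

/-- The noise scale `b`. -/
def noiseScale (n k : ℕ) (lam ε δ : ℝ) (T : ℕ) : ℝ :=
  lam * ε⁻¹ * √(8 * n * k * T * Real.log (1 / δ))

/-- The law of the noise: independent `Lap(b)` draws for every round, player and action. -/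
def noise (n k T : ℕ) (b : ℝ) : Measure (Fin T → Fin n → Fin k → ℝ) :=
  Measure.pi fun _ => Measure.pi fun _ => Measure.pi fun _ => laplaceMeasure b

/-- `1 - E[v i (j, a₋ᵢ)]` where `a₋ᵢ` is drawn from the product of the mixed strategies of the
players other than `i` (the `i`-th coordinate of `a` is overwritten by `j`). -/
def loss {n k : ℕ} (v : Fin n → Profile n k → ℝ) (p : Fin n → Mixed k) (i : Fin n)
    (j : Fin k) : ℝ :=
  1 - ∑ a : Profile n k, (∏ i', p i' (a i')) * v i (Function.update a i j)

/-- The mixed strategies computed when the noise in the rounds is `z 0, z 1, …`: uniform at first,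
then every player feeds her noisy losses to `A`. -/
def strategies {n k : ℕ} [NeZero k] (A : OnlineAlgorithm k) (v : Fin n → Profile n k → ℝ)
    (z : ℕ → Fin n → Fin k → ℝ) : ℕ → Fin n → Mixed k
  | 0 => fun _ => stdSimplex.barycenter
  | t + 1 => fun i => A (strategies A v z t i) fun j => loss v (strategies A v z t) i j + z t i j

/-- The correlated distribution returned after `T` rounds with noise `z`. (The noise is continued
by `0` after the last round; these values do not influence the strategies of the `T` rounds.) -/
def output {n k : ℕ} [NeZero k] (A : OnlineAlgorithm k) (v : Fin n → Profile n k → ℝ) (T : ℕ)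
    (z : Fin T → Fin n → Fin k → ℝ) : Profile n k → ℝ :=
  averagePlay T (strategies A v fun t => if h : t < T then z ⟨t, h⟩ else 0)

/-- The probability that the distribution returned after `T` rounds with noise scale `b` is an
`η`-approximate correlated equilibrium of the game with utility functions `v i`. -/
def probApproxCE {n k : ℕ} [NeZero k] (A : OnlineAlgorithm k) (v : Fin n → Profile n k → ℝ)
    (T : ℕ) (b η : ℝ) : ENNReal :=
  noise n k T b {z | IsApproxCE v (output A v T z) η}

/-- The condition on the noise scale. -/
def NoiseCondition (n k : ℕ) (lam ε δ β : ℝ) (T : ℕ) : Prop :=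
  noiseScale n k lam ε δ T ≤ 1 / (6 * Real.log (4 * n * k * T / β))

/-- `λ k √(n log(1/δ) log(1/β)) / ε`. -/
def ceRate (n k : ℕ) (lam ε δ β : ℝ) : ℝ :=
  lam * k * √(n * Real.log (1 / δ) * Real.log (1 / β)) / ε

end NRLaplace

end

noncomputable section

namespace NRLaplace

/-! ### Laplace noise -/

/-! Within a round the players mix independently, so a player's gain from applying `f` to her action
is linear in her own mixed strategy. The equilibrium gap of the average play is therefore her swap
regret on the true losses (`isApproxCE_averagePlay`). Regret is linear in the losses and blind to
constants, so if all noise is at most 1 in absolute value, the guarantee of the algorithm on the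
losses `(l + z + 1) / 3` bounds the true regret by `3 * R` plus the average of `-∑ j, swapDiff j * z
j` (`regret_loss_le`).

The strategies of a round depend only on earlier noise, so this last term is a martingale.
Exponential moments and a union bound over `n * k ^ k` pairs of player and rule make its sum of
order `b * √(k * L * T)`, where `L` is the logarithm in the noise condition. As `b` grows like `√T`,
the average does not depend on `T` apart from `L` (`le_probApproxCE_of_noiseCondition`).

For the concrete algorithm, exponential weights run over all `k ^ k` modification rules, and an
almost stationary distribution of their weighted mixture is played; the swap regret is of order `√(k
* log k / T)`. Such a strategy needs the past, while an online algorithm sees only its current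
distribution. Rounding leaves finitely many histories, and an arbitrarily small perturbation makes
the distribution played an injective code of the history (`exists_memoryless`). Finally `T` is the
largest admissible number of rounds: failure of the noise condition at `T + 1` bounds `T` from
below, which brings the regret down to the rate (`exists_rounds`). -/

theorem integral_exp_mul_laplace_density {b a : ℝ} (hb : 0 < b) (hab : |a| * b ≤ 1 / 2) :
    Integrable (fun z : ℝ => 1 / (2 * b) * Real.exp (-|z| / b) * Real.exp (a * z)) ∧
      ∫ z : ℝ, 1 / (2 * b) * Real.exp (-|z| / b) * Real.exp (a * z) = 1 / (1 - (a * b) ^ 2) := by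
  have hab' : |a * b| ≤ 1 / 2 := by rwa [abs_mul, abs_of_pos hb]
  obtain ⟨h1, h2⟩ := abs_le.1 hab'
  have hp : 0 < 1 / b + a := by
    rw [show 1 / b + a = (1 + a * b) / b by field_simp]
    exact div_pos (by linarith) hb
  have hn : a - 1 / b < 0 := by
    rw [show a - 1 / b = (a * b - 1) / b by field_simp]
    exact div_neg_of_neg_of_pos (by linarith) hb
  have eI : ∀ z ∈ Set.Iic (0 : ℝ), 1 / (2 * b) * Real.exp ((1 / b + a) * z) =
      1 / (2 * b) * Real.exp (-|z| / b) * Real.exp (a * z) := by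
    intro z hz
    rw [mul_assoc, ← Real.exp_add, abs_of_nonpos hz]
    congr 2; ring
  have eJ : ∀ z ∈ Set.Ioi (0 : ℝ), 1 / (2 * b) * Real.exp ((a - 1 / b) * z) =
      1 / (2 * b) * Real.exp (-|z| / b) * Real.exp (a * z) := by
    intro z hz
    rw [mul_assoc, ← Real.exp_add, abs_of_pos hz]
    congr 2; ring
  have iI := IntegrableOn.congr_fun ((integrableOn_exp_mul_Iic hp 0).const_mul (1 / (2 * b))) eI
    measurableSet_Iic
  have iJ := IntegrableOn.congr_fun ((integrableOn_exp_mul_Ioi hn 0).const_mul (1 / (2 * b))) eJ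
    measurableSet_Ioi
  refine ⟨by simpa [Set.Iic_union_Ioi] using iI.union iJ, ?_⟩
  rw [← intervalIntegral.integral_Iic_add_Ioi iI iJ,
    ← setIntegral_congr_fun measurableSet_Iic eI, ← setIntegral_congr_fun measurableSet_Ioi eJ,
    integral_const_mul, integral_const_mul, integral_exp_mul_Iic hp, integral_exp_mul_Ioi hn]
  have e2 : (1 + a * b) ≠ 0 := by linarith
  have e3 : (a * b - 1) ≠ 0 := by linarith
  rw [show 1 / b + a = (1 + a * b) / b by field_simp,
    show a - 1 / b = (a * b - 1) / b by field_simp]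
  simp only [mul_zero, Real.exp_zero]
  clear eI eJ iI iJ hp hn h1 h2 hab hab'
  generalize a * b = y at *
  rw [show 1 - y ^ 2 = -((1 + y) * (y - 1)) by ring]
  field_simp
  ring

theorem lintegral_exp_mul_laplaceMeasure {b a : ℝ} (hb : 0 < b) (hab : |a| * b ≤ 1 / 2) :
    ∫⁻ z, ENNReal.ofReal (Real.exp (a * z)) ∂laplaceMeasure b =
      ENNReal.ofReal (1 / (1 - (a * b) ^ 2)) := by
  obtain ⟨h1, h2⟩ := integral_exp_mul_laplace_density hb hab
  rw [laplaceMeasure, lintegral_withDensity_eq_lintegral_mul _ (by fun_prop) (by fun_prop), ← h2,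
    ofReal_integral_eq_lintegral_ofReal h1 (Filter.Eventually.of_forall fun z => by positivity)]
  refine lintegral_congr fun z => ?_
  rw [Pi.mul_apply, ← ENNReal.ofReal_mul (by positivity)]

theorem isProbabilityMeasure_laplaceMeasure {b : ℝ} (hb : 0 < b) :
    IsProbabilityMeasure (laplaceMeasure b) := by
  have h := lintegral_exp_mul_laplaceMeasure (a := 0) hb (by simp)
  exact ⟨by simpa using h⟩

/-- Laplace noise is subexponential. -/
theorem lintegral_exp_mul_laplaceMeasure_le {b a : ℝ} (hb : 0 < b) (hab : |a| * b ≤ 1 / 2) :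
    ∫⁻ z, ENNReal.ofReal (Real.exp (a * z)) ∂laplaceMeasure b ≤
      ENNReal.ofReal (Real.exp (2 * b ^ 2 * a ^ 2)) := by
  rw [lintegral_exp_mul_laplaceMeasure hb hab]
  apply ENNReal.ofReal_le_ofReal
  have hab' : |a * b| ≤ 1 / 2 := by rwa [abs_mul, abs_of_pos hb]
  have hx : (a * b) ^ 2 ≤ 1 / 4 := by
    have := sq_le_sq' (by linarith [abs_nonneg (a * b)]) hab'
    rw [sq_abs] at this; linarith
  have h0 := sq_nonneg (a * b)
  rw [show 2 * b ^ 2 * a ^ 2 = 2 * (a * b) ^ 2 by ring]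
  generalize (a * b) ^ 2 = x at *
  rw [div_le_iff₀ (by linarith)]
  -- For `x ≤ 1 / 4`, `(1 + 2 * x) * (1 - x) = 1 + x - 2 * x ^ 2 ≥ 1`.
  have h1 := Real.add_one_le_exp (2 * x)
  nlinarith

/-- Markov's inequality for `exp (a * z)` with `a = ± 1 / (2 * b)`, whose expectation is `4 / 3 ≤
2`; one sign for each tail. -/
theorem laplaceMeasure_gt_le {b s : ℝ} (hb : 0 < b) :
    laplaceMeasure b {z | b * s < |z|} ≤ ENNReal.ofReal (4 * Real.exp (-s / 2)) := by
  have key : ∀ a : ℝ, |a| * b = 1 / 2 →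
      laplaceMeasure b {z | s / 2 ≤ a * z} ≤ ENNReal.ofReal (2 * Real.exp (-s / 2)) := by
    intro a ha
    have h := mul_meas_ge_le_lintegral (μ := laplaceMeasure b)
      (f := fun z => ENNReal.ofReal (Real.exp (a * z))) (by fun_prop)
      (ENNReal.ofReal (Real.exp (s / 2)))
    have hs : {z | s / 2 ≤ a * z} ⊆
        {z | ENNReal.ofReal (Real.exp (s / 2)) ≤ ENNReal.ofReal (Real.exp (a * z))} :=
      fun z hz => ENNReal.ofReal_le_ofReal (Real.exp_le_exp.2 hz)
    have h2 : ENNReal.ofReal (Real.exp (s / 2)) * laplaceMeasure b {z | s / 2 ≤ a * z} ≤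
        ENNReal.ofReal 2 := by
      refine ((mul_le_mul_right (measure_mono hs) _).trans h).trans ?_
      rw [lintegral_exp_mul_laplaceMeasure hb ha.le]
      apply ENNReal.ofReal_le_ofReal
      have : (a * b) ^ 2 = 1 / 4 := by
        rw [← sq_abs, abs_mul, abs_of_pos hb, ha]; norm_num
      rw [this]; norm_num
    calc laplaceMeasure b {z | s / 2 ≤ a * z}
        = ENNReal.ofReal (Real.exp (-s / 2)) *
          (ENNReal.ofReal (Real.exp (s / 2)) * laplaceMeasure b {z | s / 2 ≤ a * z}) := by
          rw [← mul_assoc, ← ENNReal.ofReal_mul (by positivity), ← Real.exp_add]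
          simp [neg_div]
      _ ≤ ENNReal.ofReal (Real.exp (-s / 2)) * ENNReal.ofReal 2 := by gcongr
      _ = _ := by rw [← ENNReal.ofReal_mul (by positivity), mul_comm]
  have hsub : {z | b * s < |z|} ⊆
      {z | s / 2 ≤ 1 / (2 * b) * z} ∪ {z | s / 2 ≤ -(1 / (2 * b)) * z} := by
    intro z hz
    have hz' : b * s < |z| := hz
    rcases lt_abs.1 hz' with h | h
    · left
      change s / 2 ≤ 1 / (2 * b) * z
      rw [show s / 2 = 1 / (2 * b) * (b * s) by field_simp]
      gcongr
    · right
      change s / 2 ≤ -(1 / (2 * b)) * z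
      rw [show s / 2 = 1 / (2 * b) * (b * s) by field_simp, neg_mul, ← mul_neg]
      gcongr
  refine (measure_mono hsub).trans ((measure_union_le _ _).trans ?_)
  have e : |1 / (2 * b)| * b = 1 / 2 := by
    rw [abs_of_pos (by positivity)]; field_simp
  refine (add_le_add (key _ e) (key _ (by rwa [abs_neg]))).trans ?_
  rw [← ENNReal.ofReal_add (by positivity) (by positivity)]
  apply ENNReal.ofReal_le_ofReal
  linarith

theorem lintegral_prod_pi {ι : Type*} [Fintype ι] {X : ι → Type*} [∀ i, MeasurableSpace (X i)]
    (μ : (i : ι) → Measure (X i)) [∀ i, IsProbabilityMeasure (μ i)] (f : (i : ι) → X i → ENNReal)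
    (hf : ∀ i, Measurable (f i)) :
    ∫⁻ x, ∏ i, f i (x i) ∂Measure.pi μ = ∏ i, ∫⁻ y, f i y ∂μ i := by
  rw [ProbabilityTheory.lintegral_prod_eq_prod_lintegral_of_indepFun Finset.univ
    (fun i (x : (i : ι) → X i) => f i (x i))
    (ProbabilityTheory.iIndepFun_pi fun i => (hf i).aemeasurable)
    fun i => (hf i).comp (measurable_pi_apply i)]
  exact Finset.prod_congr rfl fun i _ => (measurePreserving_eval μ i).lintegral_comp (hf i)

/-- One round of noise, for all players and actions. -/
def roundNoise (n k : ℕ) (b : ℝ) : Measure (Fin n → Fin k → ℝ) :=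
  Measure.pi fun _ => Measure.pi fun _ => laplaceMeasure b

theorem lintegral_exp_sum_roundNoise_le {n k : ℕ} {b : ℝ} (hb : 0 < b) (c : Fin n → Fin k → ℝ)
    (hc : ∀ i j, |c i j| * b ≤ 1 / 2) :
    ∫⁻ x, ENNReal.ofReal (Real.exp (∑ i, ∑ j, c i j * x i j)) ∂roundNoise n k b ≤
      ENNReal.ofReal (Real.exp (2 * b ^ 2 * ∑ i, ∑ j, c i j ^ 2)) := by
  have := isProbabilityMeasure_laplaceMeasure hb
  have e : ∀ x : Fin n → Fin k → ℝ, ENNReal.ofReal (Real.exp (∑ i, ∑ j, c i j * x i j)) =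
      ∏ i, ∏ j, ENNReal.ofReal (Real.exp (c i j * x i j)) := by
    intro x
    simp_rw [Real.exp_sum]
    rw [ENNReal.ofReal_prod_of_nonneg fun i _ => by positivity]
    refine Finset.prod_congr rfl fun i _ => ?_
    rw [ENNReal.ofReal_prod_of_nonneg fun i _ => by positivity]
  simp_rw [e, roundNoise]
  rw [lintegral_prod_pi _ (fun i (y : Fin k → ℝ) =>
    ∏ j, ENNReal.ofReal (Real.exp (c i j * y j))) (by fun_prop)]
  have e2 : ENNReal.ofReal (Real.exp (2 * b ^ 2 * ∑ i, ∑ j, c i j ^ 2)) =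
      ∏ i, ∏ j, ENNReal.ofReal (Real.exp (2 * b ^ 2 * c i j ^ 2)) := by
    simp_rw [Finset.mul_sum, Real.exp_sum]
    rw [ENNReal.ofReal_prod_of_nonneg fun i _ => by positivity]
    refine Finset.prod_congr rfl fun i _ => ?_
    rw [ENNReal.ofReal_prod_of_nonneg fun i _ => by positivity]
  rw [e2]
  refine Finset.prod_le_prod' fun i _ => ?_
  rw [lintegral_prod_pi _ (fun j (y : ℝ) =>
    ENNReal.ofReal (Real.exp (c i j * y))) (by fun_prop)]
  exact Finset.prod_le_prod' fun j _ => lintegral_exp_mul_laplaceMeasure_le hb (hc i j)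

/-- With high probability, all the noise is bounded. -/
theorem noise_exists_gt_le {n k T : ℕ} {b s : ℝ} (hb : 0 < b) :
    noise n k T b {z | ∃ t i j, b * s < |z t i j|} ≤
      ENNReal.ofReal (T * n * k * (4 * Real.exp (-s / 2))) := by
  have := isProbabilityMeasure_laplaceMeasure hb
  have h1 : ∀ t i j, noise n k T b {z | b * s < |z t i j|} ≤
      ENNReal.ofReal (4 * Real.exp (-s / 2)) := by
    intro t i j
    have m1 := measurePreserving_eval (fun _ : Fin k => laplaceMeasure b) j
    have m2 := measurePreserving_eval (fun _ : Fin n => Measure.pi fun _ : Fin k =>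
      laplaceMeasure b) i
    have m3 := measurePreserving_eval (fun _ : Fin T => Measure.pi fun _ : Fin n =>
      Measure.pi fun _ : Fin k => laplaceMeasure b) t
    have m := (m1.comp m2).comp m3
    have hm : MeasurableSet {y : ℝ | b * s < |y|} :=
      measurableSet_lt measurable_const (by fun_prop)
    refine le_of_eq_of_le ?_ (laplaceMeasure_gt_le (s := s) hb)
    rw [← m.measure_preimage hm.nullMeasurableSet]
    rfl
  have e : {z : Fin T → Fin n → Fin k → ℝ | ∃ t i j, b * s < |z t i j|} =
      ⋃ t, ⋃ i, ⋃ j, {z | b * s < |z t i j|} := by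
    ext z; simp
  rw [e]
  refine (measure_iUnion_fintype_le _ _).trans ?_
  refine (Finset.sum_le_sum fun t _ => (measure_iUnion_fintype_le _ _).trans
    (Finset.sum_le_sum fun i _ => (measure_iUnion_fintype_le _ _).trans
    (Finset.sum_le_sum fun j _ => h1 t i j))).trans ?_
  simp only [Finset.sum_const, Finset.card_univ, Fintype.card_fin, nsmul_eq_mul]
  rw [ENNReal.ofReal_mul (by positivity), ENNReal.ofReal_mul (by positivity),
    ENNReal.ofReal_mul (by positivity)]
  simp [mul_assoc]

/-! ### Products along a chain driven by independent inputs -/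

/-- The state after `t` inputs. -/
def chain {S X : Type*} (step : S → X → S) (s : S) (x : ℕ → X) : ℕ → S
  | 0 => s
  | t + 1 => step (chain step s x t) (x t)

/-- The continuation of a finite sequence by `0`. -/
def extend {X : Type*} [Zero X] {T : ℕ} (z : Fin T → X) (t : ℕ) : X :=
  if h : t < T then z ⟨t, h⟩ else 0

theorem extend_coe {X : Type*} [Zero X] {T : ℕ} (z : Fin T → X) (t : Fin T) :
    extend z t = z t := by simp [extend]

theorem extend_succ {X : Type*} [Zero X] {T : ℕ} (z : Fin (T + 1) → X) (t : ℕ) :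
    extend z (t + 1) = extend (fun t => z t.succ) t := by
  simp [extend]

theorem chain_succ {S X : Type*} (step : S → X → S) (s : S) (x : ℕ → X) (t : ℕ) :
    chain step s x (t + 1) = chain step (step s (x 0)) (fun t => x (t + 1)) t := by
  induction t with
  | zero => rfl
  | succ t ih => rw [chain, ih]; rfl

/-- Replaces conditioning on the past. The first input is split off; after it the process is again a
chain from another state, and the bound is uniform in the state. Only the inequality between product
and iterated integrals is used and finite constants are pulled out, so neither `step` nor `w` has to
be measurable. -/
theorem lintegral_prod_chain_le {S X : Type*} [Zero X] [MeasurableSpace X] (ν : Measure X)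
    [IsProbabilityMeasure ν] (step : S → X → S) (w : S → X → ENNReal) (M : ENNReal)
    (hw : ∀ s, ∫⁻ x, w s x ∂ν ≤ M) (hw' : ∀ s x, w s x ≠ ⊤) (hM : M ≠ ⊤) (T : ℕ) (s : S) :
    ∫⁻ z : Fin T → X, ∏ t : Fin T, w (chain step s (extend z) t) (z t)
      ∂(Measure.pi fun _ => ν) ≤ M ^ T := by
  induction T generalizing s with
  | zero => simp
  | succ T ih =>
    have hmp := (measurePreserving_piFinSuccAbove (fun _ : Fin (T + 1) => ν) 0).symm
    rw [← hmp.lintegral_comp_emb (MeasurableEquiv.measurableEmbedding _)]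
    refine (lintegral_prod_le _).trans ?_
    have e : ∀ (x : X) (y : Fin T → X), ∏ t : Fin (T + 1), w (chain step s (extend
        ((MeasurableEquiv.piFinSuccAbove (fun _ : Fin (T + 1) => X) 0).symm (x, y))) t)
        ((MeasurableEquiv.piFinSuccAbove (fun _ : Fin (T + 1) => X) 0).symm (x, y) t) =
        w s x * ∏ t : Fin T, w (chain step (step s x) (extend y) t) (y t) := by
      intro x y
      have h0 : (MeasurableEquiv.piFinSuccAbove (fun _ : Fin (T + 1) => X) 0).symm (x, y) =
        Fin.cons x y := by
        ext t; simp [MeasurableEquiv.piFinSuccAbove]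
      rw [h0, Fin.prod_univ_succ]
      congr 1
      refine Finset.prod_congr rfl fun t _ => ?_
      rw [Fin.val_succ, chain_succ, Fin.cons_succ]
      have h1 : (fun t => extend (Fin.cons x y : Fin (T + 1) → X) (t + 1)) = extend y := by
        funext t; rw [extend_succ]; simp
      have h2 : extend (Fin.cons x y : Fin (T + 1) → X) 0 = x := by simp [extend]
      rw [h1, h2]
    simp_rw [e]
    have hMT : M ^ T ≠ ⊤ := ENNReal.pow_ne_top hM
    calc _ ≤ ∫⁻ x, w s x * M ^ T ∂ν := by
          refine lintegral_mono fun x => ?_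
          rw [lintegral_const_mul' _ _ (hw' s x)]
          gcongr
          exact ih _
      _ = (∫⁻ x, w s x ∂ν) * M ^ T := lintegral_mul_const' _ _ hMT
      _ ≤ M * M ^ T := by gcongr; exact hw s
      _ = _ := by rw [pow_succ, mul_comm]

/-! ### Regret -/

/-- The change of a distribution under a modification rule. -/
def swapDiff {k : ℕ} (f : Fin k → Fin k) (p : Mixed k) (j : Fin k) : ℝ :=
  p j - stdSimplex.map f p j

theorem sum_map_mul {k : ℕ} (f : Fin k → Fin k) (p : Mixed k) (l : Fin k → ℝ) :
    ∑ j, stdSimplex.map f p j * l j = ∑ j, p j * l (f j) := by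
  have e : ∀ j, stdSimplex.map f p j = ∑ i with f i = j, p i := fun j => by
    rw [stdSimplex.map_coe, FunOnFinite.linearMap_apply_apply]
  simp_rw [e, Finset.sum_mul]
  rw [← Finset.sum_fiberwise (s := Finset.univ) (g := f) (f := fun j => p j * l (f j))]
  refine Finset.sum_congr rfl fun j _ => Finset.sum_congr rfl fun i hi => ?_
  rw [(Finset.mem_filter.1 hi).2]

theorem sum_swapDiff_mul {k : ℕ} (f : Fin k → Fin k) (p : Mixed k) (l : Fin k → ℝ) :
    ∑ j, swapDiff f p j * l j = ∑ j, p j * (l j - l (f j)) := by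
  simp only [swapDiff, sub_mul, mul_sub, Finset.sum_sub_distrib, sum_map_mul]

theorem abs_swapDiff_le {k : ℕ} (f : Fin k → Fin k) (p : Mixed k) (j : Fin k) :
    |swapDiff f p j| ≤ 1 := by
  have h1 := stdSimplex.zero_le p j
  have h2 := stdSimplex.le_one p j
  have h3 := stdSimplex.zero_le (stdSimplex.map f p) j
  have h4 := stdSimplex.le_one (stdSimplex.map f p) j
  rw [swapDiff, abs_le]
  constructor <;> linarith

theorem sum_abs_swapDiff_le {k : ℕ} (f : Fin k → Fin k) (p : Mixed k) :
    ∑ j, |swapDiff f p j| ≤ 2 := by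
  calc ∑ j, |swapDiff f p j| ≤ ∑ j, (p j + stdSimplex.map f p j) := by
        refine Finset.sum_le_sum fun j _ => ?_
        have h1 := stdSimplex.zero_le p j
        have h3 := stdSimplex.zero_le (stdSimplex.map f p) j
        rw [swapDiff, abs_le]
        constructor <;> linarith
    _ = 2 := by
        rw [Finset.sum_add_distrib, stdSimplex.sum_eq_one, stdSimplex.sum_eq_one]; norm_num

theorem sum_sq_swapDiff_le {k : ℕ} (f : Fin k → Fin k) (p : Mixed k) :
    ∑ j, swapDiff f p j ^ 2 ≤ 2 := by
  refine le_trans (Finset.sum_le_sum fun j _ => ?_) (sum_abs_swapDiff_le f p)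
  rw [← sq_abs]
  have := abs_swapDiff_le f p j
  nlinarith [abs_nonneg (swapDiff f p j)]

theorem regret_eq {k : ℕ} (T : ℕ) (p : ℕ → Mixed k) (L : ℕ → Fin k → ℝ) (f : Fin k → Fin k) :
    regret T p L f = (1 / (T : ℝ)) * ∑ t ∈ Finset.range T, ∑ j, swapDiff f (p t) j * L t j := by
  simp only [regret, averageLoss, swapDiff, sub_mul, Finset.sum_sub_distrib, mul_sub]

theorem swapRegret_le_iff {k : ℕ} (T : ℕ) (p : ℕ → Mixed k) (L : ℕ → Fin k → ℝ) (R : ℝ) :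
    swapRegret T p L ≤ R ↔ ∀ f, regret T p L f ≤ R := by
  refine (Finset.sup'_le_iff _ _).trans ?_
  simp

/-! ### Correlated equilibria from low regret -/

theorem prod_update_mul {n k : ℕ} (p : Fin n → Mixed k) (i : Fin n) (a : Profile n k)
    (j : Fin k) :
    (∏ i', p i' (Function.update a i j i')) * p i (a i) = (∏ i', p i' (a i')) * p i j := by
  rw [← Finset.mul_prod_erase _ _ (Finset.mem_univ i),
    ← Finset.mul_prod_erase _ (fun i' => p i' (a i')) (Finset.mem_univ i)]
  have e : ∏ x ∈ Finset.univ.erase i, p x (Function.update a i j x) =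
      ∏ x ∈ Finset.univ.erase i, p x (a x) :=
    Finset.prod_congr rfl fun x hx => by rw [Function.update_of_ne (Finset.ne_of_mem_erase hx)]
  rw [e, Function.update_self]
  ring

/-- The own action can be drawn separately from the other actions. -/
theorem sum_prod_mul_eq {n k : ℕ} (p : Fin n → Mixed k) (i : Fin n)
    (G : Fin k → Profile n k → ℝ) (hG : ∀ j a x, G j (Function.update a i x) = G j a) :
    ∑ a : Profile n k, (∏ i', p i' (a i')) * G (a i) a =
      ∑ j, p i j * ∑ a : Profile n k, (∏ i', p i' (a i')) * G j a := by
  have e1 : ∑ a : Profile n k, (∏ i', p i' (a i')) * G (a i) a =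
      ∑ x : Profile n k × Fin k, (∏ i', p i' (x.1 i')) * p i x.2 * G (x.1 i) x.1 := by
    rw [Fintype.sum_prod_type]
    refine Finset.sum_congr rfl fun a _ => ?_
    simp only
    rw [← Finset.sum_mul, ← Finset.mul_sum, stdSimplex.sum_eq_one, mul_one]
  have e2 : ∑ j, p i j * ∑ a : Profile n k, (∏ i', p i' (a i')) * G j a =
      ∑ x : Profile n k × Fin k, (∏ i', p i' (x.1 i')) * p i x.2 * G x.2 x.1 := by
    rw [Fintype.sum_prod_type_right]
    refine Finset.sum_congr rfl fun j _ => ?_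
    rw [Finset.mul_sum]
    exact Finset.sum_congr rfl fun a _ => by ring
  rw [e1, e2]
  -- The involution exchanging the own action `a i` with an independent copy `j`; it preserves the
  -- weights by `prod_update_mul`.
  refine Finset.sum_nbij' (fun x => (Function.update x.1 i x.2, x.1 i))
    (fun x => (Function.update x.1 i x.2, x.1 i)) (by simp) (by simp) (by simp) (by simp) ?_
  rintro ⟨a, j⟩ -
  simp only
  rw [hG, prod_update_mul]

theorem sum_prod_eq_one {n k : ℕ} (p : Fin n → Mixed k) :
    ∑ a : Profile n k, ∏ i, p i (a i) = 1 := by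
  rw [← Fintype.prod_sum (fun i j => p i j)]
  exact Finset.prod_eq_one fun i _ => (p i).2.2

theorem sum_swap_gain_eq {n k : ℕ} (v : Fin n → Profile n k → ℝ) (p : Fin n → Mixed k)
    (i : Fin n) (f : Fin k → Fin k) :
    ∑ a : Profile n k, (∏ i', p i' (a i')) * v i (Function.update a i (f (a i))) -
      ∑ a : Profile n k, (∏ i', p i' (a i')) * v i a =
      ∑ j, swapDiff f (p i) j * loss v p i j := by
  have h1 := sum_prod_mul_eq p i (fun j a => v i (Function.update a i (f j))) (by simp)
  have h2 := sum_prod_mul_eq p i (fun j a => v i (Function.update a i j)) (by simp)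
  simp only [Function.update_eq_self] at h2
  rw [h1, h2, sum_swapDiff_mul, ← Finset.sum_sub_distrib]
  refine Finset.sum_congr rfl fun j _ => ?_
  simp only [loss]
  ring

/-- Each round is a product distribution, so `sum_swap_gain_eq` applies to it; averaging over the
rounds turns the gains into the regret. -/
theorem isApproxCE_averagePlay {n k T : ℕ} (v : Fin n → Profile n k → ℝ)
    (p : ℕ → Fin n → Mixed k) (η : ℝ)
    (h : ∀ i f, regret T (fun t => p t i) (fun t => loss v (p t) i) f ≤ η) :
    IsApproxCE v (averagePlay T p) η := by
  intro i f
  have e : ∀ H : Profile n k → ℝ, ∑ a, averagePlay T p a * H a =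
      (1 / (T : ℝ)) * ∑ t ∈ Finset.range T, ∑ a : Profile n k, (∏ i', p t i' (a i')) * H a := by
    intro H
    rw [Finset.sum_comm, Finset.mul_sum]
    refine Finset.sum_congr rfl fun a _ => ?_
    rw [averagePlay, ← Finset.sum_mul, mul_assoc]
  have h1 := h i f
  rw [regret_eq] at h1
  simp_rw [← sum_swap_gain_eq, Finset.sum_sub_distrib, mul_sub, ← e] at h1
  linarith

theorem loss_mem_Icc {n k : ℕ} {v : Fin n → Profile n k → ℝ}
    (hv : ∀ i a, 0 ≤ v i a ∧ v i a ≤ 1) (p : Fin n → Mixed k) (i : Fin n) (j : Fin k) :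
    loss v p i j ∈ Set.Icc (0 : ℝ) 1 := by
  have hW : ∀ a : Profile n k, 0 ≤ ∏ i', p i' (a i') :=
    fun a => Finset.prod_nonneg fun i' _ => stdSimplex.zero_le _ _
  have h0 : 0 ≤ ∑ a : Profile n k, (∏ i', p i' (a i')) * v i (Function.update a i j) :=
    Finset.sum_nonneg fun a _ => mul_nonneg (hW a) (hv _ _).1
  have h1 : ∑ a : Profile n k, (∏ i', p i' (a i')) * v i (Function.update a i j) ≤ 1 := by
    rw [← sum_prod_eq_one p]
    exact Finset.sum_le_sum fun a _ => mul_le_of_le_one_right (hW a) (hv _ _).2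
  rw [loss]
  constructor <;> linarith

/-! ### The strategies as a chain -/

/-- One round of the algorithm with noise `x`. -/
def strategyStep {n k : ℕ} (A : OnlineAlgorithm k) (v : Fin n → Profile n k → ℝ)
    (s : Fin n → Mixed k) (x : Fin n → Fin k → ℝ) : Fin n → Mixed k :=
  fun i => A (s i) fun j => loss v s i j + x i j

theorem strategies_eq_chain {n k : ℕ} [NeZero k] (A : OnlineAlgorithm k)
    (v : Fin n → Profile n k → ℝ) (z : ℕ → Fin n → Fin k → ℝ) (t : ℕ) :
    strategies A v z t = chain (strategyStep A v) (fun _ => stdSimplex.barycenter) z t := by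
  induction t with
  | zero => rfl
  | succ t ih => rw [chain, ← ih]; rfl

theorem measurable_mixed_apply {k : ℕ} (j : Fin k) : Measurable fun p : Mixed k => p j :=
  (measurable_pi_apply j).comp measurable_subtype_coe

theorem measurable_loss {n k : ℕ} (v : Fin n → Profile n k → ℝ) (i : Fin n) (j : Fin k) :
    Measurable fun p : Fin n → Mixed k => loss v p i j := by
  refine measurable_const.sub (Finset.measurable_sum _ fun a _ => Measurable.mul_const ?_ _)
  exact Finset.measurable_prod _ fun i' _ =>
    (measurable_mixed_apply (a i')).comp (measurable_pi_apply i')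

theorem measurable_strategies {n k T : ℕ} [NeZero k] {A : OnlineAlgorithm k}
    (hA : Measurable (Function.uncurry A)) (v : Fin n → Profile n k → ℝ) (t : ℕ) :
    Measurable fun z : Fin T → Fin n → Fin k → ℝ => strategies A v (extend z) t := by
  induction t with
  | zero => exact measurable_const
  | succ t ih =>
    refine measurable_pi_iff.2 fun i => ?_
    refine hA.comp (((measurable_pi_apply i).comp ih).prodMk (measurable_pi_iff.2 fun j => ?_))
    refine ((measurable_loss v i j).comp ih).add ?_
    unfold extend
    split_ifs
    · fun_prop
    · exact measurable_const

theorem measurable_swapDiff {k : ℕ} (f : Fin k → Fin k) (j : Fin k) :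
    Measurable fun p : Mixed k => swapDiff f p j := by
  -- Testing against the indicator of `j` exhibits `swapDiff` as a linear form in the coordinates of
  -- `p`.
  have e : (fun p : Mixed k => swapDiff f p j) =
      fun p : Mixed k => ∑ j', p j' * ((if j' = j then 1 else 0) - if f j' = j then 1 else 0) := by
    funext p
    rw [← sum_swapDiff_mul f p fun i => if i = j then 1 else 0]
    simp
  rw [e]
  exact Finset.measurable_sum _ fun j' _ => (measurable_mixed_apply j').mul_const _

/-! ### Concentration of the noise term -/

/-- Chernoff's bound. For a fixed state, one round contributes a factor at most `exp (2 * b ^ 2 * θ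
^ 2 * 2)`, since the squares of `swapDiff` sum to at most 2. -/
theorem noise_le_neg_sum_le {n k T : ℕ} [NeZero k] {A : OnlineAlgorithm k}
    (hA : Measurable (Function.uncurry A)) (v : Fin n → Profile n k → ℝ) {b θ : ℝ} (hb : 0 < b)
    (hθ : 0 ≤ θ) (hθb : θ * b ≤ 1 / 2) (i : Fin n) (f : Fin k → Fin k) (u : ℝ) :
    noise n k T b {z | u ≤ -∑ t ∈ Finset.range T,
        ∑ j, swapDiff f (strategies A v (extend z) t i) j * extend z t i j} ≤
      ENNReal.ofReal (Real.exp (4 * b ^ 2 * θ ^ 2 * T - θ * u)) := by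
  have := isProbabilityMeasure_laplaceMeasure hb
  have hP : IsProbabilityMeasure (roundNoise n k b) := by unfold roundNoise; infer_instance
  -- Only the noise of player `i` enters the exponent, but the noise of all players drives the
  -- state, so the inputs of the chain are whole rounds.
  let c : (Fin n → Mixed k) → Fin n → Fin k → ℝ :=
    fun s i' j => if i' = i then -(θ * swapDiff f (s i) j) else 0
  let w : (Fin n → Mixed k) → (Fin n → Fin k → ℝ) → ENNReal :=
    fun s x => ENNReal.ofReal (Real.exp (∑ i', ∑ j, c s i' j * x i' j))
  have hw : ∀ s, ∫⁻ x, w s x ∂roundNoise n k b ≤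
      ENNReal.ofReal (Real.exp (4 * b ^ 2 * θ ^ 2)) := by
    intro s
    refine (lintegral_exp_sum_roundNoise_le hb (c s) fun i' j => ?_).trans ?_
    · simp only [c]
      split_ifs
      · rw [abs_neg, abs_mul, abs_of_nonneg hθ]
        refine le_trans ?_ hθb
        have := abs_swapDiff_le f (s i) j
        gcongr
        exact mul_le_of_le_one_right hθ this
      · simp
    · apply ENNReal.ofReal_le_ofReal
      apply Real.exp_le_exp.2
      have e : ∑ i', ∑ j, c s i' j ^ 2 = θ ^ 2 * ∑ j, swapDiff f (s i) j ^ 2 := by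
        rw [Finset.sum_eq_single i]
        · simp only [c, if_true, neg_sq, mul_pow, Finset.mul_sum]
        · intro i' _ h; simp [c, h]
        · simp
      rw [e]
      have := sum_sq_swapDiff_le f (s i)
      calc 2 * b ^ 2 * (θ ^ 2 * ∑ j, swapDiff f (s i) j ^ 2)
          ≤ 2 * b ^ 2 * (θ ^ 2 * 2) := by gcongr
        _ = _ := by ring
  have hchain := lintegral_prod_chain_le (roundNoise n k b) (strategyStep A v) w _ hw
    (fun s x => ENNReal.ofReal_ne_top) ENNReal.ofReal_ne_top T (fun _ => stdSimplex.barycenter)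
  have ew : ∀ z : Fin T → Fin n → Fin k → ℝ,
      ∏ t : Fin T, w (chain (strategyStep A v) (fun _ => stdSimplex.barycenter) (extend z) t)
        (z t) = ENNReal.ofReal (Real.exp (θ * -∑ t ∈ Finset.range T,
        ∑ j, swapDiff f (strategies A v (extend z) t i) j * extend z t i j)) := by
    intro z
    rw [← Fin.sum_univ_eq_sum_range (fun t =>
      ∑ j, swapDiff f (strategies A v (extend z) t i) j * extend z t i j), mul_neg,
      Finset.mul_sum, ← Finset.sum_neg_distrib, Real.exp_sum,
      ENNReal.ofReal_prod_of_nonneg fun i _ => by positivity]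
    refine Finset.prod_congr rfl fun t _ => ?_
    simp only [w]
    congr 2
    rw [Finset.sum_eq_single i]
    · simp only [c, if_true, Finset.mul_sum, ← Finset.sum_neg_distrib, ← strategies_eq_chain,
        extend_coe]
      exact Finset.sum_congr rfl fun j _ => by ring
    · intro i' _ h; simp [c, h]
    · simp
  simp_rw [ew] at hchain
  -- Markov's inequality is where the measurability of `A` enters.
  have hmeas : Measurable fun z : Fin T → Fin n → Fin k → ℝ =>
      ∑ t ∈ Finset.range T,
        ∑ j, swapDiff f (strategies A v (extend z) t i) j * extend z t i j := by
    refine Finset.measurable_sum _ fun t _ => Finset.measurable_sum _ fun j _ => ?_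
    refine ((measurable_swapDiff f j).comp
      ((measurable_pi_apply i).comp (measurable_strategies hA v t))).mul ?_
    unfold extend
    split_ifs
    · fun_prop
    · exact measurable_const
  have hmk := mul_meas_ge_le_lintegral (μ := noise n k T b)
    (f := fun z => ENNReal.ofReal (Real.exp (θ * -∑ t ∈ Finset.range T,
        ∑ j, swapDiff f (strategies A v (extend z) t i) j * extend z t i j)))
    (by fun_prop) (ENNReal.ofReal (Real.exp (θ * u)))
  set S := {z : Fin T → Fin n → Fin k → ℝ | u ≤ -∑ t ∈ Finset.range T,
        ∑ j, swapDiff f (strategies A v (extend z) t i) j * extend z t i j} with hS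
  have h2 : ENNReal.ofReal (Real.exp (θ * u)) * noise n k T b S ≤
      ENNReal.ofReal (Real.exp (4 * b ^ 2 * θ ^ 2)) ^ T := by
    refine le_trans ?_ (hmk.trans hchain)
    gcongr
    intro z hz
    exact ENNReal.ofReal_le_ofReal (Real.exp_le_exp.2 (mul_le_mul_of_nonneg_left hz hθ))
  calc noise n k T b S
      = ENNReal.ofReal (Real.exp (-(θ * u))) *
        (ENNReal.ofReal (Real.exp (θ * u)) * noise n k T b S) := by
        rw [← mul_assoc, ← ENNReal.ofReal_mul (by positivity), ← Real.exp_add]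
        simp
    _ ≤ ENNReal.ofReal (Real.exp (-(θ * u))) *
        ENNReal.ofReal (Real.exp (4 * b ^ 2 * θ ^ 2)) ^ T := by gcongr
    _ = _ := by
        rw [← ENNReal.ofReal_pow (by positivity), ← ENNReal.ofReal_mul (by positivity),
          ← Real.exp_nat_mul, ← Real.exp_add]
        congr 2; ring

/-! ### The regret on a good realization of the noise -/

/-- Once the noise is fixed, the adaptive losses are one particular loss sequence, so the regret
guarantee of `A` applies to it. -/
theorem run_eq_strategies {n k : ℕ} [NeZero k] (A : OnlineAlgorithm k)
    (v : Fin n → Profile n k → ℝ) (z : ℕ → Fin n → Fin k → ℝ) (i : Fin n) (t : ℕ) :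
    A.run (fun t j => (loss v (strategies A.rescaled v z t) i j + z t i j + 1) / 3) t =
      strategies A.rescaled v z t i := by
  induction t with
  | zero => rfl
  | succ t ih => rw [OnlineAlgorithm.run, ih]; rfl

/-- Noise bounded by 1 keeps `(l + z + 1) / 3` in `[0, 1]`. As `swapDiff` sums to zero over the
actions, the shift by 1 contributes no regret, and the factor `1 / 3` turns `R` into `3 * R`. -/
theorem regret_loss_le {n k T : ℕ} [NeZero k] {A : OnlineAlgorithm k} {R : ℝ}
    (hR : HasSwapRegretAtMost A T R) {v : Fin n → Profile n k → ℝ}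
    (hv : ∀ i a, 0 ≤ v i a ∧ v i a ≤ 1) (z : ℕ → Fin n → Fin k → ℝ)
    (hz : ∀ t i j, |z t i j| ≤ 1) (i : Fin n) (f : Fin k → Fin k) :
    regret T (fun t => strategies A.rescaled v z t i)
      (fun t => loss v (strategies A.rescaled v z t) i) f ≤
      3 * R + (1 / (T : ℝ)) * -∑ t ∈ Finset.range T,
        ∑ j, swapDiff f (strategies A.rescaled v z t i) j * z t i j := by
  have h := (swapRegret_le_iff _ _ _ _).1
    (hR (fun t j => (loss v (strategies A.rescaled v z t) i j + z t i j + 1) / 3) ?_) f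
  · rw [regret_eq] at h ⊢
    simp_rw [run_eq_strategies] at h
    have e : ∀ t, ∑ j, swapDiff f (strategies A.rescaled v z t i) j *
        ((loss v (strategies A.rescaled v z t) i j + z t i j + 1) / 3) =
        1 / 3 * (∑ j, swapDiff f (strategies A.rescaled v z t i) j *
          loss v (strategies A.rescaled v z t) i j +
          ∑ j, swapDiff f (strategies A.rescaled v z t i) j * z t i j) := by
      intro t
      have e0 := sum_swapDiff_mul f (strategies A.rescaled v z t i) (fun _ => 1)
      simp only [sub_self, mul_zero, Finset.sum_const_zero] at e0
      rw [← add_zero (_ + ∑ j, swapDiff f (strategies A.rescaled v z t i) j * z t i j), ← e0,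
        ← Finset.sum_add_distrib, ← Finset.sum_add_distrib, Finset.mul_sum]
      exact Finset.sum_congr rfl fun j _ => by ring
    simp_rw [e, ← Finset.mul_sum, Finset.sum_add_distrib] at h
    linarith
  · intro t j
    have h1 := loss_mem_Icc hv (strategies A.rescaled v z t) i j
    have h2 := abs_le.1 (hz t i j)
    constructor <;> linarith [h1.1, h1.2]

theorem abs_sum_swapDiff_mul_le {k T : ℕ} (p : ℕ → Mixed k) (f : Fin k → Fin k)
    (z : ℕ → Fin k → ℝ) {B : ℝ} (hz : ∀ t j, |z t j| ≤ B) :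
    |∑ t ∈ Finset.range T, ∑ j, swapDiff f (p t) j * z t j| ≤ T * (2 * B) := by
  refine (Finset.abs_sum_le_sum_abs _ _).trans ?_
  rw [← nsmul_eq_mul]
  conv_rhs => rw [← Finset.card_range T]
  refine Finset.sum_le_card_nsmul _ _ _ fun t _ => ?_
  refine (Finset.abs_sum_le_sum_abs _ _).trans ?_
  calc ∑ j, |swapDiff f (p t) j * z t j| ≤ ∑ j, |swapDiff f (p t) j| * B := by
        refine Finset.sum_le_sum fun j _ => ?_
        rw [abs_mul]
        gcongr
        exact hz t j
    _ = (∑ j, |swapDiff f (p t) j|) * B := by rw [Finset.sum_mul]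
    _ ≤ 2 * B := by
        -- `0 ≤ B` follows from `hz` only if there is an action; without actions there is no
        -- distribution `p t`.
        rcases isEmpty_or_nonempty (Fin k) with h | ⟨⟨j⟩⟩
        · have := stdSimplex.sum_eq_one (p t)
          simp at this
        · gcongr
          · exact (abs_nonneg _).trans (hz t j)
          · exact sum_abs_swapDiff_le f (p t)

/-! ### Every low-regret algorithm computes an approximate correlated equilibrium -/

/-- Half of the failure probability pays for noise beyond `b * s`, the other half for `bad`. The set
`bad` is left open because many rounds require a deviation event and few rounds require none. -/
theorem le_probApproxCE {n k T : ℕ} [NeZero k] (hT : 1 ≤ T) {A : OnlineAlgorithm k} {R : ℝ}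
    (hR : HasSwapRegretAtMost A T R) {v : Fin n → Profile n k → ℝ}
    (hv : ∀ i a, 0 ≤ v i a ∧ v i a ≤ 1) {b s β E : ℝ} (hb : 0 < b) (hs : 0 ≤ s) (hbs : b * s ≤ 1)
    (hβ : 0 < β) (hβ' : T * n * k * (4 * Real.exp (-s / 2)) ≤ β / 2)
    (bad : Set (Fin T → Fin n → Fin k → ℝ)) (hbad : noise n k T b bad ≤ ENNReal.ofReal (β / 2))
    (h : ∀ z ∉ bad, (∀ t i j, |extend z t i j| ≤ b * s) → ∀ i f,
      -∑ t ∈ Finset.range T, ∑ j, swapDiff f (strategies A.rescaled v (extend z) t i) j *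
        extend z t i j ≤ T * E) :
    ENNReal.ofReal (1 - β) ≤ probApproxCE A.rescaled v T b (3 * R + E) := by
  have := isProbabilityMeasure_laplaceMeasure hb
  have hP : IsProbabilityMeasure (noise n k T b) := by unfold noise; infer_instance
  have hT0 : (0 : ℝ) < T := by exact_mod_cast hT
  set large : Set (Fin T → Fin n → Fin k → ℝ) := {z | ∃ t i j, b * s < |z t i j|} with hl
  -- A covering and subadditivity, instead of complements, so that no event has to be measurable.
  have hsub : (Set.univ : Set (Fin T → Fin n → Fin k → ℝ)) ⊆
      {z | IsApproxCE v (output A.rescaled v T z) (3 * R + E)} ∪ (large ∪ bad) := by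
    intro z _
    by_cases h1 : z ∈ large
    · exact Or.inr (Or.inl h1)
    by_cases h2 : z ∈ bad
    · exact Or.inr (Or.inr h2)
    left
    have hz : ∀ t i j, |extend z t i j| ≤ b * s := by
      intro t i j
      by_cases ht : t < T
      · rw [show t = ((⟨t, ht⟩ : Fin T) : ℕ) from rfl, extend_coe]
        by_contra hc
        exact h1 ⟨_, i, j, not_le.1 hc⟩
      · simp only [extend, ht, dite_false, Pi.zero_apply, abs_zero]
        positivity
    -- `output` continues the noise exactly as `extend` does, so the two sides agree by definition.
    refine isApproxCE_averagePlay v (strategies A.rescaled v (extend z)) _ fun i f => ?_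
    refine (regret_loss_le hR hv _ (fun t i j => (hz t i j).trans hbs) i f).trans ?_
    gcongr
    rw [one_div, inv_mul_le_iff₀ hT0]
    exact h z h2 hz i f
  have h1 : (1 : ENNReal) ≤ probApproxCE A.rescaled v T b (3 * R + E) + ENNReal.ofReal β := by
    calc (1 : ENNReal) = noise n k T b Set.univ := measure_univ.symm
      _ ≤ _ := measure_mono hsub
      _ ≤ _ := measure_union_le _ _
      _ ≤ probApproxCE A.rescaled v T b (3 * R + E) + (ENNReal.ofReal (β / 2) +
          ENNReal.ofReal (β / 2)) := by
          refine add_le_add le_rfl ((measure_union_le _ _).trans (add_le_add ?_ hbad))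
          exact (noise_exists_gt_le hb).trans (ENNReal.ofReal_le_ofReal hβ')
      _ = _ := by
          rw [← ENNReal.ofReal_add (by positivity) (by positivity), add_halves]
  rw [ENNReal.ofReal_sub _ hβ.le, ENNReal.ofReal_one]
  exact tsub_le_iff_right.2 h1

/-- Isolates the factor `K = lam / ε * √(n * log (1 / δ))` shared with `ceRate`; later estimates
compare noise and rate through `K`. -/
theorem noiseScale_eq {n k T : ℕ} {lam ε δ : ℝ} (hδ : 0 < δ) (hδ' : δ < 1) :
    noiseScale n k lam ε δ T =
      lam / ε * √(n * Real.log (1 / δ)) * √8 * √k * √T := by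
  have hD : 0 < Real.log (1 / δ) := Real.log_pos (by rw [lt_div_iff₀ hδ]; linarith)
  rw [noiseScale, show (8 : ℝ) * n * k * T * Real.log (1 / δ) =
    (n * Real.log (1 / δ)) * 8 * k * T by ring, Real.sqrt_mul (by positivity),
    Real.sqrt_mul (by positivity), Real.sqrt_mul (by positivity)]
  ring

theorem ceRate_eq {n k : ℕ} {lam ε δ β : ℝ} (hδ : 0 < δ) (hδ' : δ < 1) :
    ceRate n k lam ε δ β =
      lam / ε * √(n * Real.log (1 / δ)) * k * √(Real.log (1 / β)) := by
  have hD : 0 < Real.log (1 / δ) := Real.log_pos (by rw [lt_div_iff₀ hδ]; linarith)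
  rw [ceRate, Real.sqrt_mul (by positivity)]
  ring

theorem half_le_log_inv {β : ℝ} (hβ : 0 < β) (hβ' : β ≤ 1 / 2) : 1 / 2 ≤ Real.log (1 / β) := by
  have h : Real.log 2 ≤ Real.log (1 / β) := by
    apply Real.log_le_log (by norm_num)
    rw [le_div_iff₀ hβ]; linarith
  linarith [Real.log_two_gt_d9]

theorem two_le_log {x β : ℝ} (hx : 4 ≤ x) (hβ : 0 < β) (hβ' : β ≤ 1 / 2) :
    2 ≤ Real.log (x / β) := by
  rw [Real.le_log_iff_exp_le (by positivity)]
  have h8 : 8 ≤ x / β := by rw [le_div_iff₀ hβ]; linarith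
  have h1 := Real.exp_one_lt_d9
  have h2 : Real.exp 2 = Real.exp 1 ^ 2 := by rw [← Real.exp_nat_mul]; norm_num
  rw [h2]
  nlinarith [Real.exp_pos 1]

theorem four_le_mul {n k T : ℕ} [NeZero n] [NeZero k] (hT : 1 ≤ T) : (4 : ℝ) ≤ 4 * n * k * T := by
  have hn : 1 ≤ n := NeZero.one_le
  have hk : 1 ≤ k := NeZero.one_le
  have h : 4 * (1 * 1 * 1) ≤ 4 * (n * k * T) := by gcongr
  have h' : (4 : ℝ) ≤ ((4 * (n * k * T) : ℕ) : ℝ) := by exact_mod_cast h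
  push_cast at h'
  linarith

theorem sqrt_eight_le : √8 ≤ (3 : ℝ) := by
  rw [Real.sqrt_le_left (by norm_num)]; norm_num

theorem half_le_sqrt {x : ℝ} (hx : 1 / 2 ≤ x) : 1 / 2 ≤ √x :=
  Real.le_sqrt_of_sq_le (by linarith)

/-- For the union bound over players and rules: the exponential is `(β / (4 * n * k * T)) ^ k`,
whose `k`-th power of `k` cancels the number `k ^ k` of rules. -/
theorem mul_pow_mul_exp_neg_le {n k T : ℕ} [NeZero n] [NeZero k] (hT : 1 ≤ T) {β : ℝ}
    (hβ : 0 < β) (hβ' : β ≤ 1 / 2) :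
    n * k ^ k * Real.exp (-(k * Real.log (4 * n * k * T / β))) ≤ β / 2 := by
  have hn : (1 : ℝ) ≤ n := by exact_mod_cast NeZero.one_le
  have hk : (1 : ℝ) ≤ k := by exact_mod_cast NeZero.one_le
  have hT' : (1 : ℝ) ≤ T := by exact_mod_cast hT
  have e : Real.exp (-(k * Real.log (4 * n * k * T / β))) = (β / (4 * n * T)) ^ k * (1 / k) ^ k := by
    rw [← mul_neg, ← Real.log_inv, Real.exp_nat_mul, Real.exp_log (by positivity), ← mul_pow]
    congr 1
    field_simp
  have h1 : β / (4 * n * T) ≤ 1 := by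
    rw [div_le_one (by positivity)]
    nlinarith
  have h2 : (β / (4 * n * T)) ^ k ≤ β / (4 * n * T) :=
    pow_le_of_le_one (by positivity) h1 (NeZero.ne k)
  rw [e]
  calc (n : ℝ) * k ^ k * ((β / (4 * n * T)) ^ k * (1 / k) ^ k)
      = n * (β / (4 * n * T)) ^ k := by
        rw [one_div, inv_pow]; field_simp
    _ ≤ n * (β / (4 * n * T)) := by gcongr
    _ = β / (4 * T) := by field_simp
    _ ≤ β / 2 := by gcongr; linarith

theorem le_probApproxCE_of_noiseCondition {n k : ℕ} [NeZero n] [NeZero k] {lam ε δ β : ℝ}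
    (hlam : 0 < lam) (hε : 0 < ε) (hδ : 0 < δ) (hδ' : δ < 1) (hβ : 0 < β) (hβ' : β ≤ 1 / 2)
    {T : ℕ} (hT : 1 ≤ T) (hnc : NoiseCondition n k lam ε δ β T) {A : OnlineAlgorithm k} {R : ℝ}
    (hA : Measurable (Function.uncurry A)) (hR : HasSwapRegretAtMost A T R)
    {v : Fin n → Profile n k → ℝ} (hv : ∀ i a, 0 ≤ v i a ∧ v i a ≤ 1) :
    ENNReal.ofReal (1 - β) ≤ probApproxCE A.rescaled v T (noiseScale n k lam ε δ T)
      (3 * R + 100 * ceRate n k lam ε δ β * Real.log (4 * n * k * T / β) ^ 2) := by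
  have hn : (1 : ℝ) ≤ n := by exact_mod_cast NeZero.one_le
  have hk : (1 : ℝ) ≤ k := by exact_mod_cast NeZero.one_le
  have hT' : (1 : ℝ) ≤ T := by exact_mod_cast hT
  have hD : 0 < Real.log (1 / δ) := Real.log_pos (by rw [lt_div_iff₀ hδ]; linarith)
  have hL2 : 2 ≤ Real.log (4 * n * k * T / β) := two_le_log (four_le_mul hT) hβ hβ'
  have hunion := mul_pow_mul_exp_neg_le (n := n) (k := k) hT hβ hβ'
  have hexp : Real.exp (-Real.log (4 * n * k * T / β)) = β / (4 * n * k * T) := by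
    rw [← Real.log_inv, Real.exp_log (by positivity), inv_div]
  unfold NoiseCondition at hnc
  have hbe := noiseScale_eq (n := n) (k := k) (T := T) (lam := lam) (ε := ε) hδ hδ'
  have hge := ceRate_eq (n := n) (k := k) (lam := lam) (ε := ε) (β := β) hδ hδ'
  have hK : 0 < lam / ε * √(n * Real.log (1 / δ)) := by positivity
  have hβL := half_le_sqrt (half_le_log_inv hβ hβ')
  generalize lam / ε * √(n * Real.log (1 / δ)) = K at *
  generalize √(Real.log (1 / β)) = q at *
  generalize Real.log (4 * n * k * T / β) = L at *
  have hb : 0 < noiseScale n k lam ε δ T := by rw [hbe]; positivity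
  generalize noiseScale n k lam ε δ T = b at *
  rw [hge]
  have hbs : b * (6 * L) ≤ 1 := by rwa [le_div_iff₀ (by positivity)] at hnc
  -- The exponential is `exp (-3 * L)`. One factor `exp (-L)` cancels the number `T * n * k` of
  -- noise variables, and `exp (-2 * L) ≤ 1 / 2` halves `β`.
  have htail : T * n * k * (4 * Real.exp (-(6 * L) / 2)) ≤ β / 2 := by
    have e : Real.exp (-(6 * L) / 2) = Real.exp (-L) * Real.exp (-(2 * L)) := by
      rw [← Real.exp_add]; congr 1; ring
    have h1 : Real.exp (-(2 * L)) ≤ 1 / 2 := by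
      rw [Real.exp_neg, one_div]
      gcongr
      have := Real.add_one_le_exp (2 * L)
      linarith
    rw [e, hexp]
    calc (T : ℝ) * n * k * (4 * (β / (4 * n * k * T) * Real.exp (-(2 * L))))
        = β * Real.exp (-(2 * L)) := by field_simp
      _ ≤ β * (1 / 2) := by gcongr
      _ = _ := by ring
  have h8 := sqrt_eight_le
  have hsT : √(T : ℝ) * √(T : ℝ) = T := Real.mul_self_sqrt (by positivity)
  have hsk : √(k : ℝ) * √(k : ℝ) = k := Real.mul_self_sqrt (by positivity)
  have hsL : √L * √L = L := Real.mul_self_sqrt (by positivity)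
  have hsL1 : 1 ≤ √L := Real.one_le_sqrt.2 (by linarith)
  -- The exponential moment requires `θ * b ≤ 1 / 2`, which for the `θ` below means `k * L ≤ T`. For
  -- fewer rounds `b` is so small that the triangle inequality suffices.
  by_cases hc : k * L ≤ T
  -- This `θ` minimizes `4 * b ^ 2 * θ ^ 2 * T - θ * u`, and `u` makes the minimum `-(k * L)`.
  · set θ := √k * √L / (2 * b * √T) with hθ
    set u := 4 * b * (√k * √L * √T) with hu
    have hθ0 : 0 ≤ θ := by positivity
    have hθb : θ * b ≤ 1 / 2 := by
      have : √k * √L ≤ √T := by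
        rw [← Real.sqrt_mul (by positivity)]
        exact Real.sqrt_le_sqrt hc
      rw [hθ, div_mul_eq_mul_div, div_le_iff₀ (by positivity)]
      nlinarith
    have hexpo : 4 * b ^ 2 * θ ^ 2 * T - θ * u = -(k * L) := by
      have hT0 : √(T : ℝ) ≠ 0 := by positivity
      rw [hθ, hu]
      rw [← hsT, ← hsk, ← hsL]
      field_simp
      simp only [Real.sqrt_sq (Real.sqrt_nonneg _)]
      ring
    refine le_probApproxCE hT hR hv hb (s := 6 * L) (by positivity) hbs hβ htail
      (⋃ i : Fin n, ⋃ f : Fin k → Fin k, {z | u ≤ -∑ t ∈ Finset.range T,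
        ∑ j, swapDiff f (strategies A.rescaled v (extend z) t i) j * extend z t i j}) ?_ ?_
    · have hA' : Measurable (Function.uncurry A.rescaled) := by
        have h : Measurable fun x : Mixed k × (Fin k → ℝ) => (x.1, fun j => (x.2 j + 1) / 3) := by
          fun_prop
        exact hA.comp h
      refine (measure_iUnion_fintype_le _ _).trans ?_
      refine (Finset.sum_le_sum fun i _ => (measure_iUnion_fintype_le _ _).trans
        (Finset.sum_le_sum fun f _ => noise_le_neg_sum_le hA' v hb hθ0 hθb i f u)).trans ?_
      rw [hexpo]
      simp only [Finset.sum_const, Finset.card_univ, Fintype.card_fin, Fintype.card_pi,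
        Finset.prod_const, nsmul_eq_mul]
      refine le_trans (le_of_eq ?_) (ENNReal.ofReal_le_ofReal hunion)
      rw [ENNReal.ofReal_mul (by positivity), ENNReal.ofReal_mul (by positivity),
        ENNReal.ofReal_pow (by positivity)]
      simp [mul_assoc]
    · intro z hz _ i f
      simp only [Set.mem_iUnion, Set.mem_ofPred_eq, not_exists, not_le] at hz
      refine (hz i f).le.trans ?_
      rw [hu, hbe]
      calc 4 * (K * √8 * √k * √T) * (√k * √L * √T)
          = (√T * √T) * (K * (√k * √k) * (4 * √8 * √L)) := by ring
        _ = T * (K * k * (4 * √8 * √L)) := by rw [hsT, hsk]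
        _ ≤ T * (K * k * (100 * q * L ^ 2)) := by
          refine mul_le_mul_of_nonneg_left (mul_le_mul_of_nonneg_left ?_ (by positivity))
            (by positivity)
          have h1 : √L ≤ L ^ 2 := by nlinarith
          calc 4 * √8 * √L ≤ 4 * 3 * L ^ 2 := by gcongr
            _ ≤ 100 * q * L ^ 2 := mul_le_mul_of_nonneg_right (by linarith) (by positivity)
        _ = _ := by ring
  · refine le_probApproxCE hT hR hv hb (s := 6 * L) (by positivity) hbs hβ htail ∅ (by simp) ?_
    intro z _ hz i f
    refine (neg_le_abs _).trans ((abs_sum_swapDiff_mul_le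
      (fun t => strategies A.rescaled v (extend z) t i) f
      (fun t => extend z t i) (fun t j => hz t i j)).trans ?_)
    refine mul_le_mul_of_nonneg_left ?_ (by positivity)
    have hT2 : √T ≤ √k * √L := by
      rw [← Real.sqrt_mul (by positivity)]
      exact Real.sqrt_le_sqrt (not_le.1 hc).le
    rw [hbe]
    calc 2 * (K * √8 * √k * √T * (6 * L)) ≤ 2 * (K * 3 * √k * (√k * √L) * (6 * L)) := by gcongr
      _ = K * (√k * √k) * (36 * (√L * L)) := by ring
      _ = K * k * (36 * (√L * L)) := by rw [hsk]
      _ ≤ K * k * (100 * q * L ^ 2) := by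
        refine mul_le_mul_of_nonneg_left ?_ (by positivity)
        have h1 : √L ≤ L := by nlinarith
        -- The constant 100 has to absorb 36, given `q ≥ 1 / 2`.
        calc 36 * (√L * L) ≤ 36 * (L * L) := by gcongr
          _ ≤ 100 * q * (L * L) := by gcongr; linarith
          _ = _ := by ring
      _ = _ := by ring

/-! ### Exponential weights -/

/-- `(1 - x + x ^ 2 / 2) * (1 + x + x ^ 2 / 2) = 1 + x ^ 4 / 4 ≥ 1`, and the second factor is at
most `exp x`. -/
theorem exp_neg_le_quadratic {x : ℝ} (hx : 0 ≤ x) : Real.exp (-x) ≤ 1 - x + x ^ 2 / 2 := by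
  have h := Real.quadratic_le_exp_of_nonneg hx
  rw [Real.exp_neg, inv_le_iff_one_le_mul₀ (Real.exp_pos x)]
  have h1 : 0 ≤ 1 - x + x ^ 2 / 2 := by nlinarith [sq_nonneg (x - 1)]
  calc 1 ≤ (1 - x + x ^ 2 / 2) * (1 + x + x ^ 2 / 2) := by nlinarith [sq_nonneg (x ^ 2)]
    _ ≤ _ := by gcongr

/-- The exponential weights bound for an algorithm that loses at most `e` per round more than the
weighted average of the experts. -/
theorem sum_le_of_exp_weights {ι : Type*} [Fintype ι] {η e : ℝ} (hη : 0 < η)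
    (c m : ℕ → ι → ℝ) (a : ℕ → ℝ) (hc0 : ∀ i, c 0 i = 0)
    (hc : ∀ t i, c (t + 1) i = c t i + m t i) (hm : ∀ t i, m t i ∈ Set.Icc (0 : ℝ) 1)
    (ha : ∀ t, (∑ i, Real.exp (-η * c t i)) * (a t - e) ≤ ∑ i, Real.exp (-η * c t i) * m t i)
    (T : ℕ) (i : ι) :
    ∑ t ∈ Finset.range T, a t ≤
      c T i + Real.log (Fintype.card ι) / η + η * T / 2 + e * T := by
  -- The total weight is the potential: a round multiplies it by at most `exp (-η * (a T - e) + η ^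
  -- 2 / 2)`. At the end it dominates the weight of the single expert `i`.
  have key : ∀ T : ℕ, ∑ i, Real.exp (-η * c T i) ≤
      Fintype.card ι * Real.exp (-η * ∑ t ∈ Finset.range T, a t + η * e * T + η ^ 2 / 2 * T) := by
    intro T
    induction T with
    | zero => simp [hc0]
    | succ T ih =>
      have h1 : ∑ i, Real.exp (-η * c (T + 1) i) ≤
          (∑ i, Real.exp (-η * c T i)) * (1 - η * (a T - e) + η ^ 2 / 2) := by
        calc ∑ i, Real.exp (-η * c (T + 1) i)
            ≤ ∑ i, Real.exp (-η * c T i) * (1 - η * m T i + η ^ 2 / 2) := by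
              refine Finset.sum_le_sum fun i _ => ?_
              rw [hc, mul_add, Real.exp_add]
              refine mul_le_mul_of_nonneg_left ?_ (Real.exp_pos _).le
              obtain ⟨h0, h1⟩ := hm T i
              have h2 := exp_neg_le_quadratic (mul_nonneg hη.le h0)
              have h3 : (η * m T i) ^ 2 ≤ η ^ 2 := by
                rw [mul_pow]
                exact mul_le_of_le_one_right (sq_nonneg η) (pow_le_one₀ h0 h1)
              rw [neg_mul]
              linarith
          _ = (∑ i, Real.exp (-η * c T i)) * (1 + η ^ 2 / 2) -
              η * ∑ i, Real.exp (-η * c T i) * m T i := by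
              rw [Finset.sum_mul, Finset.mul_sum, ← Finset.sum_sub_distrib]
              exact Finset.sum_congr rfl fun i _ => by ring
          _ ≤ _ := by
              have := mul_le_mul_of_nonneg_left (ha T) hη.le
              linarith
      have h2 : 1 - η * (a T - e) + η ^ 2 / 2 ≤ Real.exp (-η * (a T - e) + η ^ 2 / 2) := by
        have := Real.add_one_le_exp (-η * (a T - e) + η ^ 2 / 2)
        linarith
      calc ∑ i, Real.exp (-η * c (T + 1) i)
          ≤ (∑ i, Real.exp (-η * c T i)) * Real.exp (-η * (a T - e) + η ^ 2 / 2) :=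
            h1.trans (mul_le_mul_of_nonneg_left h2 (Finset.sum_nonneg fun i _ => (Real.exp_pos _).le))
        _ ≤ Fintype.card ι *
            Real.exp (-η * ∑ t ∈ Finset.range T, a t + η * e * T + η ^ 2 / 2 * T) *
            Real.exp (-η * (a T - e) + η ^ 2 / 2) := by gcongr
        _ = _ := by
            rw [mul_assoc, ← Real.exp_add, Finset.sum_range_succ]
            congr 2
            push_cast
            ring
  have : Nonempty ι := ⟨i⟩
  have h1 : Real.exp (-η * c T i) ≤ _ :=
    (Finset.single_le_sum (fun i _ => (Real.exp_pos (-η * c T i)).le)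
      (Finset.mem_univ i)).trans (key T)
  have h2 := Real.log_le_log (Real.exp_pos _) h1
  rw [Real.log_mul (by positivity) (Real.exp_pos _).ne', Real.log_exp, Real.log_exp] at h2
  rw [← sub_nonneg]
  have h3 : 0 ≤ (Real.log (Fintype.card ι) + η * c T i - η * ∑ t ∈ Finset.range T, a t +
    η * e * T + η ^ 2 / 2 * T) / η := div_nonneg (by linarith) hη.le
  refine h3.trans (le_of_eq ?_)
  field_simp
  ring

/-! ### Approximately stationary distributions -/

/-- `q` is the law of `f j` for independent `f ∼ w` and `j ∼ p`: one step of a Markov chain. -/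
theorem exists_mixed_of_weights {k : ℕ} (w : (Fin k → Fin k) → ℝ) (hw : ∀ f, 0 ≤ w f)
    (hw1 : ∑ f, w f = 1) (p : Mixed k) :
    ∃ q : Mixed k, ∀ l : Fin k → ℝ, ∑ j, q j * l j = ∑ f, w f * ∑ j, p j * l (f j) := by
  have e : ∀ l : Fin k → ℝ, ∑ j, (∑ f, w f * stdSimplex.map f p j) * l j =
      ∑ f, w f * ∑ j, p j * l (f j) := by
    intro l
    simp_rw [Finset.sum_mul]
    rw [Finset.sum_comm]
    refine Finset.sum_congr rfl fun f _ => ?_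
    rw [← sum_map_mul, Finset.mul_sum]
    exact Finset.sum_congr rfl fun j _ => by ring
  refine ⟨⟨fun j => ∑ f, w f * stdSimplex.map f p j,
    fun j => Finset.sum_nonneg fun f _ => mul_nonneg (hw f) (stdSimplex.zero_le _ _), ?_⟩, e⟩
  have := e fun _ => 1
  simpa [stdSimplex.sum_eq_one, hw1] using this

theorem sum_mul_mem_Icc {k : ℕ} (p : Mixed k) {l : Fin k → ℝ}
    (hl : ∀ j, l j ∈ Set.Icc (0 : ℝ) 1) : ∑ j, p j * l j ∈ Set.Icc (0 : ℝ) 1 := by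
  refine ⟨Finset.sum_nonneg fun j _ => mul_nonneg (stdSimplex.zero_le _ _) (hl j).1, ?_⟩
  rw [← stdSimplex.sum_eq_one p]
  exact Finset.sum_le_sum fun j _ => mul_le_of_le_one_right (stdSimplex.zero_le _ _) (hl j).2

/-- The average of `N` iterates of the chain: one more step changes the expectation of `l` by a
telescoping sum, hence by at most `1 / N`. -/
theorem exists_almost_stationary {k : ℕ} [NeZero k] (w : (Fin k → Fin k) → ℝ)
    (hw : ∀ f, 0 ≤ w f) (hw1 : ∑ f, w f = 1) {N : ℕ} (hN : 1 ≤ N) :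
    ∃ p : Mixed k, ∀ l : Fin k → ℝ, (∀ j, l j ∈ Set.Icc (0 : ℝ) 1) →
      ∑ j, p j * l j - 1 / N ≤ ∑ f, w f * ∑ j, p j * l (f j) := by
  choose next hnext using exists_mixed_of_weights w hw hw1
  let q : ℕ → Mixed k := fun m => next^[m] stdSimplex.barycenter
  have hN0 : (N : ℝ) ≠ 0 := by positivity
  have e : ∀ l : Fin k → ℝ, ∑ j, (1 / (N : ℝ) * ∑ m ∈ Finset.range N, q m j) * l j =
      1 / (N : ℝ) * ∑ m ∈ Finset.range N, ∑ j, q m j * l j := by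
    intro l
    rw [Finset.sum_comm, Finset.mul_sum]
    refine Finset.sum_congr rfl fun j _ => ?_
    rw [← Finset.sum_mul, mul_assoc]
  refine ⟨⟨fun j => 1 / (N : ℝ) * ∑ m ∈ Finset.range N, q m j, fun j =>
    mul_nonneg (by positivity) (Finset.sum_nonneg fun m _ => stdSimplex.zero_le _ _), ?_⟩, ?_⟩
  · have := e fun _ => 1
    simpa [stdSimplex.sum_eq_one, hN0] using this
  · intro l hl
    change ∑ j, (1 / (N : ℝ) * ∑ m ∈ Finset.range N, q m j) * l j - 1 / N ≤
      ∑ f, w f * ∑ j, (1 / (N : ℝ) * ∑ m ∈ Finset.range N, q m j) * l (f j)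
    have e2 : ∑ f, w f * ∑ j, (1 / (N : ℝ) * ∑ m ∈ Finset.range N, q m j) * l (f j) =
        1 / (N : ℝ) * ∑ m ∈ Finset.range N, ∑ j, q (m + 1) j * l j := by
      have e3 : ∀ m, ∑ j, q (m + 1) j * l j = ∑ f, w f * ∑ j, q m j * l (f j) := fun m => by
        simp only [q, Function.iterate_succ_apply']
        exact hnext _ l
      simp_rw [e3]
      rw [Finset.sum_comm, Finset.mul_sum]
      refine Finset.sum_congr rfl fun f _ => ?_
      rw [e fun j => l (f j), ← Finset.mul_sum]
      ring
    rw [e, e2]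
    have h1 := Finset.sum_range_sub (fun m => ∑ j, q m j * l j) N
    rw [Finset.sum_sub_distrib] at h1
    have h2 := (sum_mul_mem_Icc (q 0) hl).2
    have h3 := (sum_mul_mem_Icc (q N) hl).1
    have h4 : ∑ m ∈ Finset.range N, ∑ j, q m j * l j - 1 ≤
        ∑ m ∈ Finset.range N, ∑ j, q (m + 1) j * l j := by linarith
    have h5 := mul_le_mul_of_nonneg_left h4 (by positivity : 0 ≤ 1 / (N : ℝ))
    linarith

/-- For each `j`, `f j` is uniform when `f` is. This makes the prescribed uniform start an
admissible choice before any loss is seen, when all weights are equal. -/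
theorem barycenter_stationary {k : ℕ} [NeZero k] (l : Fin k → ℝ) :
    ∑ f : Fin k → Fin k, ∑ j, (stdSimplex.barycenter : Mixed k) j * l (f j) =
      Fintype.card (Fin k → Fin k) * ∑ j, (stdSimplex.barycenter : Mixed k) j * l j := by
  have hk : (k : ℝ) ≠ 0 := by exact_mod_cast NeZero.ne k
  have hb : ∀ j, (stdSimplex.barycenter : Mixed k) j = (k : ℝ)⁻¹ := fun j =>
    (stdSimplex.barycenter_apply j).trans (by simp)
  simp only [hb, ← Finset.mul_sum]
  rw [Finset.sum_comm]
  have h : ∀ j : Fin k, ∑ f : Fin k → Fin k, l (f j) = (k : ℝ) ^ (k - 1) * ∑ i, l i := by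
    intro j
    have := Fintype.sum_piFinset_apply l Finset.univ j
    simpa using this
  simp only [h, Finset.sum_const, Finset.card_univ, Fintype.card_fin, nsmul_eq_mul,
    Fintype.card_pi, Finset.prod_const, Nat.cast_pow]
  have : (k : ℝ) ^ k = k * k ^ (k - 1) := (mul_pow_sub_one (NeZero.ne k) _).symm
  rw [this]
  ring

/-- A distribution that is almost stationary for the modification rules with exponential weights,
and uniform when all the weights are equal. -/
theorem exists_stationary_choice (k : ℕ) [NeZero k] (η : ℝ) {N : ℕ} (hN : 1 ≤ N) :
    ∃ S : ((Fin k → Fin k) → ℝ) → Mixed k, S 0 = stdSimplex.barycenter ∧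
      ∀ c (l : Fin k → ℝ), (∀ j, l j ∈ Set.Icc (0 : ℝ) 1) →
        (∑ f, Real.exp (-η * c f)) * (∑ j, S c j * l j - 1 / N) ≤
          ∑ f, Real.exp (-η * c f) * ∑ j, S c j * l (f j) := by
  classical
  have hpos : ∀ c : (Fin k → Fin k) → ℝ, 0 < ∑ f, Real.exp (-η * c f) := fun c =>
    Finset.sum_pos (fun f _ => Real.exp_pos _) ⟨id, Finset.mem_univ _⟩
  have h : ∀ c : (Fin k → Fin k) → ℝ, ∃ p : Mixed k, ∀ l : Fin k → ℝ,
      (∀ j, l j ∈ Set.Icc (0 : ℝ) 1) →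
        (∑ f, Real.exp (-η * c f)) * (∑ j, p j * l j - 1 / N) ≤
          ∑ f, Real.exp (-η * c f) * ∑ j, p j * l (f j) := by
    intro c
    obtain ⟨p, hp⟩ := exists_almost_stationary
      (fun f => Real.exp (-η * c f) / ∑ f, Real.exp (-η * c f))
      (fun f => div_nonneg (Real.exp_pos _).le (hpos c).le)
      (by rw [← Finset.sum_div, div_self (hpos c).ne']) hN
    refine ⟨p, fun l hl => ?_⟩
    have h1 := mul_le_mul_of_nonneg_left (hp l hl) (hpos c).le
    refine h1.trans (le_of_eq ?_)
    rw [Finset.mul_sum]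
    refine Finset.sum_congr rfl fun f _ => ?_
    rw [← mul_assoc, mul_div_cancel₀ _ (hpos c).ne']
  choose S hS using h
  refine ⟨fun c => if c = 0 then stdSimplex.barycenter else S c, by simp, fun c l hl => ?_⟩
  by_cases hc : c = 0
  · subst hc
    have h0 : (0 : ℝ) ≤ 1 / N := by positivity
    have := barycenter_stationary l
    simp only [if_true, Pi.zero_apply, mul_zero, Real.exp_zero, one_mul, Finset.sum_const,
      Finset.card_univ, nsmul_eq_mul, mul_one]
    rw [this]
    gcongr
    linarith
  · simpa only [hc, if_false] using hS c l hl

/-! ### Injective encodings -/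

/-- A connected space with two points has no isolated point, so every ball is infinite. -/
theorem exists_mixed_near {k : ℕ} (hk : 2 ≤ k) (p : Mixed k) (F : Set (Mixed k)) (hF : F.Finite)
    {e : ℝ} (he : 0 < e) : ∃ q : Mixed k, q ∉ F ∧ dist q p ≤ e := by
  have : Nontrivial (Fin k) := Fin.nontrivial_iff_two_le.2 hk
  have : NeZero k := ⟨by omega⟩
  have : ConnectedSpace (Mixed k) :=
    Subtype.connectedSpace (isPathConnected_stdSimplex (Fin k)).isConnected
  have : Nontrivial (Mixed k) := by
    obtain ⟨i, j, hij⟩ := exists_pair_ne (Fin k)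
    exact ⟨⟨stdSimplex.vertex i, stdSimplex.vertex j, fun h => hij (stdSimplex.vertex_injective h)⟩⟩
  have h := infinite_of_mem_nhds p (Metric.closedBall_mem_nhds p he)
  obtain ⟨q, hq, hqF⟩ := (h.sdiff hF).nonempty
  exact ⟨q, hqF, hq⟩

/-- Values are moved one at a time off the finitely many already used. The value at `i₀` stays put,
because a run must start at the uniform distribution exactly. -/
theorem exists_injOn_near {k : ℕ} (hk : 2 ≤ k) {ι : Type*} (g : ι → Mixed k) (i₀ : ι)
    (s : Set ι) (hs : s.Finite) {e : ℝ} (he : 0 < e) :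
    ∃ g' : ι → Mixed k, Set.InjOn g' (insert i₀ s) ∧ g' i₀ = g i₀ ∧ ∀ i, dist (g' i) (g i) ≤ e := by
  classical
  induction s, hs using Set.Finite.induction_on with
  | empty => exact ⟨g, by simp, rfl, by simp [he.le]⟩
  | @insert a s ha hs ih =>
    obtain ⟨g', h1, h2, h3⟩ := ih
    by_cases hai : a = i₀
    · subst hai
      exact ⟨g', by simpa using h1, h2, h3⟩
    · obtain ⟨q, hq, hq'⟩ := exists_mixed_near hk (g a) (g' '' insert i₀ s)
        ((hs.insert i₀).image g') he
      have ha' : a ∉ insert i₀ s := by simp [hai, ha]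
      refine ⟨Function.update g' a q, ?_, ?_, ?_⟩
      · rw [Set.insert_comm, Set.injOn_insert ha']
        refine ⟨?_, ?_⟩
        · refine h1.congr fun x hx => ?_
          rw [Function.update_of_ne]
          rintro rfl; exact ha' hx
        · rw [Function.update_self]
          rintro ⟨x, hx, hxq⟩
          refine hq ⟨x, hx, ?_⟩
          rw [← hxq, Function.update_of_ne]
          rintro rfl; exact ha' hx
      · rw [Function.update_of_ne (Ne.symm hai), h2]
      · intro i
        by_cases hi : i = a
        · subst hi; rwa [Function.update_self]
        · rw [Function.update_of_ne hi]; exact h3 i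

/-! ### A no-swap-regret algorithm

The algorithm rounds the losses to multiples of `1 / N`. There are finitely many sequences of at
most `T` rounded losses, so that the sequence seen so far can be read off the distribution played,
after an arbitrarily small perturbation. -/

/-- A vector of losses that are multiples of `1 / N`. -/
abbrev RoundedLoss (k N : ℕ) := Fin k → Fin (N + 1)

/-- Rounding down to multiples of `1 / N`. -/
def roundLoss {k : ℕ} (N : ℕ) (l : Fin k → ℝ) : RoundedLoss k N :=
  fun j => Fin.ofNat (N + 1) ⌊N * l j⌋₊

/-- The values of rounded losses. -/
def lossValue {k N : ℕ} (a : RoundedLoss k N) (j : Fin k) : ℝ := (a j : ℕ) / N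

theorem lossValue_mem_Icc {k N : ℕ} (a : RoundedLoss k N) (j : Fin k) :
    lossValue a j ∈ Set.Icc (0 : ℝ) 1 := by
  refine ⟨by unfold lossValue; positivity, div_le_one_of_le₀ ?_ (by positivity)⟩
  exact_mod_cast Nat.lt_succ_iff.1 (a j).2

/-- On `[0, 1]` the floor is at most `N`, so the reduction modulo `N + 1` in `Fin.ofNat` has no
effect. -/
theorem lossValue_roundLoss {k N : ℕ} (hN : 1 ≤ N) {l : Fin k → ℝ}
    (hl : ∀ j, l j ∈ Set.Icc (0 : ℝ) 1) (j : Fin k) :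
    lossValue (roundLoss N l) j ≤ l j ∧ l j ≤ lossValue (roundLoss N l) j + 1 / N := by
  have hN0 : (0 : ℝ) < N := by exact_mod_cast hN
  have h0 : 0 ≤ N * l j := mul_nonneg hN0.le (hl j).1
  have h1 : ⌊N * l j⌋₊ < N + 1 := by
    have : N * l j ≤ N := mul_le_of_le_one_right hN0.le (hl j).2
    exact Nat.lt_succ_iff.2 (Nat.floor_le_of_le this)
  have e : lossValue (roundLoss N l) j = (⌊N * l j⌋₊ : ℝ) / N := by
    simp only [lossValue, roundLoss, Fin.val_ofNat, Nat.mod_eq_of_lt h1]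
  rw [e, ← add_div, div_le_iff₀ hN0, le_div_iff₀ hN0]
  have h2 := Nat.floor_le h0
  have h3 := (Nat.lt_floor_add_one (N * l j)).le
  constructor <;> linarith

theorem measurable_roundLoss {k : ℕ} (N : ℕ) :
    Measurable (roundLoss N : (Fin k → ℝ) → RoundedLoss k N) := by
  refine measurable_pi_iff.2 fun j => ?_
  exact (measurable_from_top (f := Fin.ofNat (N + 1))).comp
    (Nat.measurable_floor.comp ((measurable_pi_apply j).const_mul _))

/-- The cumulative losses of the modification rules against the choices `S`. -/
def cumLoss {k N : ℕ} (S : ((Fin k → Fin k) → ℝ) → Mixed k) :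
    List (RoundedLoss k N) → (Fin k → Fin k) → ℝ
  | [] => 0
  | a :: h => fun f => cumLoss S h f + ∑ j, S (cumLoss S h) j * lossValue a (f j)

/-- The rounded losses of the first `t` rounds, the last ones first. -/
def lossHistory {k : ℕ} (N : ℕ) (L : ℕ → Fin k → ℝ) : ℕ → List (RoundedLoss k N)
  | 0 => []
  | t + 1 => roundLoss N (L t) :: lossHistory N L t

theorem length_lossHistory {k : ℕ} (N : ℕ) (L : ℕ → Fin k → ℝ) (t : ℕ) :
    (lossHistory N L t).length = t := by
  induction t with
  | zero => rfl
  | succ t ih => simp [lossHistory, ih]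

/-- Any strategy that depends on the rounded losses is played up to an arbitrarily small error by
a measurable memoryless algorithm. -/
theorem exists_memoryless {k : ℕ} [NeZero k] (hk : 2 ≤ k) (N T : ℕ)
    (g : List (RoundedLoss k N) → Mixed k) (hg : g [] = stdSimplex.barycenter) {e : ℝ}
    (he : 0 < e) :
    ∃ A : OnlineAlgorithm k, Measurable (Function.uncurry A) ∧
      ∀ (L : ℕ → Fin k → ℝ) (t : ℕ), t ≤ T →
        ∀ j, |A.run L t j - g (lossHistory N L t) j| ≤ e := by
  classical
  have hfin : {h : List (RoundedLoss k N) | h.length ≤ T}.Finite := List.finite_length_le _ T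
  obtain ⟨enc, hinj, h0, hnear⟩ := exists_injOn_near hk g [] _ hfin he
  have hinj' : Set.InjOn enc {h | h.length ≤ T} := hinj.mono (Set.subset_insert _ _)
  let dec : Mixed k → List (RoundedLoss k N) := fun p =>
    if h : ∃ x : List (RoundedLoss k N), x.length ≤ T ∧ enc x = p then h.choose else []
  have hdec : ∀ x : List (RoundedLoss k N), x.length ≤ T → dec (enc x) = x := by
    intro x hx
    have h : ∃ y : List (RoundedLoss k N), y.length ≤ T ∧ enc y = enc x := ⟨x, hx, rfl⟩
    simp only [dec, h, dite_true]
    exact hinj' h.choose_spec.1 hx h.choose_spec.2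
  let _ : MeasurableSpace (List (RoundedLoss k N)) := ⊤
  -- Outside the finite set of codes the decoder is the constant `[]`.
  have hdecm : Measurable dec := by
    refine Measurable.measurable_of_countable_ne
      (measurable_const (a := ([] : List (RoundedLoss k N)))) ?_
    refine ((hfin.image enc).subset fun p hp => ?_).countable
    by_contra hc
    refine hp ?_
    have : ¬ ∃ x : List (RoundedLoss k N), x.length ≤ T ∧ enc x = p := hc
    simp only [dec, this, dite_false]
  refine ⟨fun p l => enc (roundLoss N l :: dec p), ?_, ?_⟩
  · have h1 : Measurable fun x : Mixed k × (Fin k → ℝ) => (dec x.1, roundLoss N x.2) :=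
      (hdecm.comp measurable_fst).prodMk ((measurable_roundLoss N).comp measurable_snd)
    have h2 : Measurable fun y : List (RoundedLoss k N) × RoundedLoss k N => enc (y.2 :: y.1) :=
      measurable_of_countable _
    exact h2.comp h1
  · intro L t ht
    have hrun : ∀ t ≤ T, OnlineAlgorithm.run (fun p l => enc (roundLoss N l :: dec p)) L t =
        enc (lossHistory N L t) := by
      intro t
      induction t with
      | zero => intro _; exact (h0.trans hg).symm
      | succ t ih =>
        intro ht
        rw [OnlineAlgorithm.run, ih (by omega), hdec _ (by rw [length_lossHistory]; omega)]
        rfl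
    intro j
    rw [hrun t ht]
    exact (dist_pi_le_iff he.le).1 (hnear (lossHistory N L t)) j

theorem abs_sum_mul_sub_sum_mul_le {k : ℕ} (p q : Mixed k) (x y : Fin k → ℝ) {e d : ℝ}
    (hpq : ∀ j, |p j - q j| ≤ e) (hx : ∀ j, |x j| ≤ 1) (hxy : ∀ j, |x j - y j| ≤ d) :
    |∑ j, p j * x j - ∑ j, q j * y j| ≤ k * e + d := by
  have e1 : ∑ j, p j * x j - ∑ j, q j * y j =
      ∑ j, ((p j - q j) * x j + q j * (x j - y j)) := by
    rw [← Finset.sum_sub_distrib]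
    exact Finset.sum_congr rfl fun j _ => by ring
  rw [e1]
  calc |∑ j, ((p j - q j) * x j + q j * (x j - y j))|
      ≤ ∑ j, (e + q j * d) := by
        refine (Finset.abs_sum_le_sum_abs _ _).trans (Finset.sum_le_sum fun j _ => ?_)
        refine (abs_add_le _ _).trans (add_le_add ?_ ?_)
        · rw [abs_mul]
          exact (mul_le_of_le_one_right (abs_nonneg _) (hx j)).trans (hpq j)
        · rw [abs_mul, abs_of_nonneg (stdSimplex.zero_le q j)]
          exact mul_le_mul_of_nonneg_left (hxy j) (stdSimplex.zero_le q j)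
    _ = k * e + d := by
        rw [Finset.sum_add_distrib, ← Finset.sum_mul, stdSimplex.sum_eq_one]
        simp

/-- The experts are the modification rules: `f` suffers the loss of the current distribution moved
by `f`, so regret to the expert `f` is regret to the rule. Their number has logarithm `k * log k`.
The slack `γ` is split evenly between non-stationarity, rounding and perturbation. -/
theorem exists_hasSwapRegretAtMost_add {k T : ℕ} [NeZero k] (hk : 2 ≤ k) (hT : 1 ≤ T) {γ : ℝ}
    (hγ : 0 < γ) :
    ∃ A : OnlineAlgorithm k, Measurable (Function.uncurry A) ∧
      HasSwapRegretAtMost A T (√2 * √(k * Real.log k / T) + γ) := by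
  have hT0 : (0 : ℝ) < T := by exact_mod_cast hT
  have hk0 : (0 : ℝ) < k := by exact_mod_cast (by omega : 0 < k)
  have hlogk : 0 < Real.log k := Real.log_pos (by exact_mod_cast (by omega : 1 < k))
  obtain ⟨N', hN'⟩ := exists_nat_one_div_lt (div_pos hγ (by norm_num : (0 : ℝ) < 3))
  set N := N' + 1 with hN
  have hN1 : 1 ≤ N := by omega
  have hNγ : 1 / (N : ℝ) ≤ γ / 3 := by rw [hN]; push_cast; exact hN'.le
  set ρ := √(k * Real.log k / T) with hρ
  have hρ0 : 0 < ρ := by positivity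
  have hρ2 : ρ * ρ = k * Real.log k / T := Real.mul_self_sqrt (by positivity)
  -- The minimizer of `ρ ^ 2 * T / η + η * T / 2`, with minimum `η * T`.
  set η := √2 * ρ with hη
  have hη0 : 0 < η := by positivity
  obtain ⟨S, hS0, hS⟩ := exists_stationary_choice k η hN1
  obtain ⟨A, hAm, hA⟩ := exists_memoryless hk N T
    (fun h => S (cumLoss S h)) (by simpa [cumLoss] using hS0)
    (div_pos hγ (by positivity : (0 : ℝ) < 3 * k))
  refine ⟨A, hAm, fun L hL => (swapRegret_le_iff _ _ _ _).2 fun f => ?_⟩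
  set c : ℕ → (Fin k → Fin k) → ℝ := fun t => cumLoss S (lossHistory N L t) with hc
  set ℓ : ℕ → Fin k → ℝ := fun t => lossValue (roundLoss N (L t)) with hℓ
  have hew := sum_le_of_exp_weights (e := 1 / N) hη0 c
    (fun t f => ∑ j, S (c t) j * ℓ t (f j)) (fun t => ∑ j, S (c t) j * ℓ t j)
    (fun f => by simp [hc, lossHistory, cumLoss]) (fun t f => rfl)
    (fun t f => sum_mul_mem_Icc _ fun j => lossValue_mem_Icc _ _)
    (fun t => hS _ _ fun j => lossValue_mem_Icc _ _) T f
  have hcT : c T f = ∑ t ∈ Finset.range T, ∑ j, S (c t) j * ℓ t (f j) := by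
    have := Finset.sum_range_sub (fun t => c t f) T
    have h0 : c 0 f = 0 := by simp [hc, lossHistory, cumLoss]
    rw [h0, sub_zero] at this
    rw [← this]
    refine Finset.sum_congr rfl fun t _ => ?_
    change c t f + ∑ j, S (c t) j * ℓ t (f j) - c t f = _
    ring
  have hround : ∀ t < T, ∑ j, swapDiff f (A.run L t) j * L t j ≤
      ∑ j, S (c t) j * ℓ t j - ∑ j, S (c t) j * ℓ t (f j) + 2 * γ / 3 := by
    intro t ht
    have h1 := abs_sum_mul_sub_sum_mul_le (A.run L t) (S (c t)) (fun j => L t j - L t (f j))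
      (fun j => ℓ t j - ℓ t (f j)) (d := γ / 3) (hA L t ht.le)
      (fun j => by
        obtain ⟨a1, a2⟩ := hL t j
        obtain ⟨b1, b2⟩ := hL t (f j)
        rw [abs_le]; constructor <;> linarith)
      (fun j => by
        obtain ⟨a1, a2⟩ := lossValue_roundLoss hN1 (hL t) j
        obtain ⟨b1, b2⟩ := lossValue_roundLoss hN1 (hL t) (f j)
        simp only [hℓ]
        rw [abs_le]; constructor <;> linarith)
    have h2 : k * (γ / (3 * k)) = γ / 3 := by field_simp
    rw [h2] at h1
    rw [sum_swapDiff_mul, ← Finset.sum_sub_distrib]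
    simp_rw [← mul_sub]
    linarith [(abs_le.1 h1).2]
  have hsum := Finset.sum_le_sum fun t ht => hround t (Finset.mem_range.1 ht)
  rw [Finset.sum_add_distrib, Finset.sum_sub_distrib, ← hcT] at hsum
  simp only [Finset.sum_const, Finset.card_range, nsmul_eq_mul] at hsum
  have hcard : Real.log (Fintype.card (Fin k → Fin k)) = ρ * ρ * T := by
    rw [hρ2]
    simp only [Fintype.card_pi, Fintype.card_fin, Finset.prod_const, Finset.card_univ]
    push_cast
    rw [Real.log_pow]
    field_simp
  rw [hcard] at hew
  have h2 : √2 * √2 = (2 : ℝ) := Real.mul_self_sqrt (by norm_num)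
  have hs2 : (0 : ℝ) < √2 := by positivity
  have hterm : ρ * ρ * T / η + η * T / 2 = η * T := by
    have : ρ * ρ * T / η = η * T / 2 := by
      rw [div_eq_iff hη0.ne', hη]
      linear_combination (-(ρ * ρ * T) / 2) * h2
    rw [this]; ring
  rw [regret_eq, one_div, inv_mul_le_iff₀ hT0]
  have h3 : 1 / (N : ℝ) * T ≤ γ / 3 * T := by gcongr
  linarith

/-- There is a memoryless algorithm with small swap regret. -/
theorem exists_hasSwapRegretAtMost (k T : ℕ) [NeZero k] (hT : 1 ≤ T) :
    ∃ A : OnlineAlgorithm k, Measurable (Function.uncurry A) ∧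
      HasSwapRegretAtMost A T (2 * √(k * Real.log k / T)) := by
  have hk1 : 1 ≤ k := NeZero.one_le
  -- With one action the bound is 0 and the identity is the only rule. Otherwise the gap between
  -- `√2` and 2 pays for `γ`.
  rcases hk1.eq_or_lt with rfl | hk
  · refine ⟨fun _ _ => stdSimplex.barycenter, measurable_const, fun L _ =>
      (swapRegret_le_iff _ _ _ _).2 fun f => ?_⟩
    have hf : f = id := by ext j; omega
    simp only [regret_eq, sum_swapDiff_mul, hf, id_eq, sub_self, mul_zero,
      Finset.sum_const_zero]
    positivity
  · have hT0 : (0 : ℝ) < T := by exact_mod_cast hT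
    have hlogk : 0 < Real.log k := Real.log_pos (by exact_mod_cast hk)
    have hρ : 0 < √(k * Real.log k / T) := by positivity
    have h2 : √2 < (2 : ℝ) := by rw [Real.sqrt_lt' (by norm_num)]; norm_num
    obtain ⟨A, hA, hR⟩ := exists_hasSwapRegretAtMost_add hk hT
      (γ := (2 - √2) * √(k * Real.log k / T)) (mul_pos (by linarith) hρ)
    refine ⟨A, hA, ?_⟩
    rwa [← add_mul, add_sub_cancel] at hR

/-- The squared inequality is `4 * k ≤ 2 * k ^ 2` up to a common factor, which vanishes for `k = 1`.
-/
theorem two_mul_sqrt_le {k T : ℕ} [NeZero k] :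
    2 * √(k * Real.log k / T) ≤ k * √(2 * Real.log k / T) := by
  have hk1 : 1 ≤ k := NeZero.one_le
  rcases hk1.eq_or_lt with rfl | hk
  · simp
  · have hk' : (2 : ℝ) ≤ k := by exact_mod_cast hk
    have hlogk : 0 ≤ Real.log k := Real.log_nonneg (by linarith)
    refine (sq_le_sq₀ (by positivity) (by positivity)).1 ?_
    rw [mul_pow, mul_pow, Real.sq_sqrt (by positivity), Real.sq_sqrt (by positivity),
      ← mul_div_assoc, ← mul_div_assoc]
    gcongr ?_ / _
    nlinarith [mul_nonneg (mul_nonneg (by linarith : (0 : ℝ) ≤ k) hlogk)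
      (by linarith : (0 : ℝ) ≤ k - 2)]

open Classical in
/-- The no-swap-regret algorithm for `k` actions and `T` rounds. -/
def swapAlgorithm (k T : ℕ) : OnlineAlgorithm k :=
  if h : ∃ _ : NeZero k, 1 ≤ T then
    have := h.choose
    (exists_hasSwapRegretAtMost k T h.choose_spec).choose
  else fun p _ => p

theorem swapAlgorithm_spec (k T : ℕ) [hk : NeZero k] (hT : 1 ≤ T) :
    Measurable (Function.uncurry (swapAlgorithm k T)) ∧
      HasSwapRegretAtMost (swapAlgorithm k T) T (2 * √(k * Real.log k / T)) := by
  have h : ∃ _ : NeZero k, 1 ≤ T := ⟨hk, hT⟩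
  rw [swapAlgorithm, dif_pos h]
  exact (exists_hasSwapRegretAtMost k T hT).choose_spec

/-! ### The number of rounds -/

/-- With `X = 4 * n * k / β`, the hypothesis gives `T * g ^ 2 ≤ X ^ 2`, so `log T ≤ 2 * log X + 2 *
|log g|`. -/
theorem log_le_add_abs_log {n k T : ℕ} [NeZero n] [NeZero k] (hT : 1 ≤ T) {g β : ℝ} (hg : 0 < g)
    (hβ : 0 < β) (hβ' : β ≤ 1 / 2) (hTg : T * (8 * g ^ 2) ≤ k * Real.log (1 / β)) :
    Real.log (4 * n * k * T / β) ≤ 3 * (Real.log (4 * n * k / β) + |Real.log g|) := by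
  have hn : (1 : ℝ) ≤ n := by exact_mod_cast NeZero.one_le
  have hk : (1 : ℝ) ≤ k := by exact_mod_cast NeZero.one_le
  have hT' : (1 : ℝ) ≤ T := by exact_mod_cast hT
  have hX : 0 < 4 * n * k / β := by positivity
  have e : 4 * n * k * T / β = 4 * n * k / β * T := by ring
  rw [e, Real.log_mul (by positivity) (by positivity)]
  have h1 : (T : ℝ) * g ^ 2 ≤ (4 * n * k / β) ^ 2 := by
    have h2 := Real.log_le_sub_one_of_pos (show 0 < 1 / β by positivity)
    have h3 : (k : ℝ) * (1 / β) ≤ 4 * n * k / β := by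
      rw [mul_one_div]
      gcongr
      nlinarith
    have h4 : 1 ≤ 4 * n * k / β := by
      rw [le_div_iff₀ hβ]; nlinarith
    calc (T : ℝ) * g ^ 2 ≤ T * (8 * g ^ 2) := by gcongr; nlinarith [sq_nonneg g]
      _ ≤ k * Real.log (1 / β) := hTg
      _ ≤ k * (1 / β) := by gcongr; linarith
      _ ≤ 4 * n * k / β := h3
      _ ≤ _ := by nlinarith
  have h5 := Real.log_le_log (by positivity) h1
  rw [Real.log_mul (by positivity) (by positivity), Real.log_pow, Real.log_pow] at h5
  push_cast at h5
  have h6 := neg_abs_le (Real.log g)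
  linarith [abs_nonneg (Real.log g)]

theorem NoiseCondition.mul_le_one {n k T : ℕ} [NeZero n] [NeZero k] {lam ε δ β : ℝ}
    (hβ : 0 < β) (hβ' : β ≤ 1 / 2) (hT : 1 ≤ T) (h : NoiseCondition n k lam ε δ β T) :
    noiseScale n k lam ε δ T * (6 * Real.log (4 * n * k * T / β)) ≤ 1 := by
  have hL := two_le_log (four_le_mul (n := n) (k := k) hT) hβ hβ'
  rwa [NoiseCondition, le_div_iff₀ (by positivity)] at h

/-- The noise condition forces `b ≤ 1`, hence `8 * K ^ 2 * k * T ≤ 1`, so a largest admissible `T`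
exists. Its failure at `T + 1` bounds `1 / √T` by a multiple of `K * √k` times a logarithm;
multiplied by `√(k * log k)` this is the rate. -/
theorem exists_rounds {n k : ℕ} [NeZero n] [NeZero k] {lam ε δ β : ℝ}
    (hlam : 0 < lam) (hε : 0 < ε) (hδ : 0 < δ) (hδ' : δ < 1) (hβ : 0 < β) (hβ' : β ≤ 1 / 2)
    (h : ∃ T₀ : ℕ, 1 ≤ T₀ ∧ NoiseCondition n k lam ε δ β T₀) :
    ∃ T : ℕ, 1 ≤ T ∧ NoiseCondition n k lam ε δ β T ∧
      Real.log (4 * n * k * T / β) ≤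
        3 * (Real.log (4 * n * k / β) + |Real.log (ceRate n k lam ε δ β)|) ∧
      √(k * Real.log k / T) ≤ 600 * ceRate n k lam ε δ β *
        (Real.log (4 * n * k / β) + |Real.log (ceRate n k lam ε δ β)|) ^ 2 := by
  have hn : (1 : ℝ) ≤ n := by exact_mod_cast NeZero.one_le
  have hk : (1 : ℝ) ≤ k := by exact_mod_cast NeZero.one_le
  have hD : 0 < Real.log (1 / δ) := Real.log_pos (by rw [lt_div_iff₀ hδ]; linarith)
  have hge := ceRate_eq (n := n) (k := k) (lam := lam) (ε := ε) (β := β) hδ hδ'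
  have hbe := fun T => noiseScale_eq (n := n) (k := k) (T := T) (lam := lam) (ε := ε) hδ hδ'
  set K := lam / ε * √(n * Real.log (1 / δ)) with hKdef
  have hK : 0 < K := by positivity
  have hq := half_le_sqrt (half_le_log_inv hβ hβ')
  have hβpos : 0 < Real.log (1 / β) := by linarith [half_le_log_inv hβ hβ']
  have hq2 : √(Real.log (1 / β)) ^ 2 = Real.log (1 / β) := Real.sq_sqrt hβpos.le
  set q := √(Real.log (1 / β))
  clear_value K q
  have hg : 0 < ceRate n k lam ε δ β := by rw [hge]; positivity
  have hs8 : √8 ^ 2 = (8 : ℝ) := Real.sq_sqrt (by norm_num)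
  have hsk : √(k : ℝ) ^ 2 = k := Real.sq_sqrt (by positivity)
  have hbound : ∀ T : ℕ, 1 ≤ T → NoiseCondition n k lam ε δ β T → K ^ 2 * 8 * k * T ≤ 1 := by
    intro T hT hc
    have hsT : √(T : ℝ) ^ 2 = T := Real.sq_sqrt (by positivity)
    have h1 := hc.mul_le_one hβ hβ' hT
    have hL := two_le_log (four_le_mul (n := n) (k := k) hT) hβ hβ'
    have hb : 0 ≤ noiseScale n k lam ε δ T := by rw [hbe]; positivity
    have h2 : noiseScale n k lam ε δ T ≤ 1 := by nlinarith
    calc K ^ 2 * 8 * k * T = noiseScale n k lam ε δ T ^ 2 := by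
          rw [hbe]
          linear_combination (-K ^ 2 * k * T) * hs8 - K ^ 2 * √8 ^ 2 * T * hsk -
            K ^ 2 * √8 ^ 2 * √k ^ 2 * hsT
      _ ≤ 1 := pow_le_one₀ hb h2
  classical
  obtain ⟨T₀, hT₀, hc₀⟩ := h
  set M := ⌊1 / (K ^ 2 * 8 * k)⌋₊
  have hM : ∀ T : ℕ, 1 ≤ T → NoiseCondition n k lam ε δ β T → T ≤ M := by
    intro T hT hc
    refine Nat.le_floor ?_
    rw [le_div_iff₀ (by positivity), mul_comm]
    exact hbound T hT hc
  set T := Nat.findGreatest (fun T => 1 ≤ T ∧ NoiseCondition n k lam ε δ β T) M with hTdef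
  obtain ⟨hT, hc⟩ : 1 ≤ T ∧ NoiseCondition n k lam ε δ β T :=
    Nat.findGreatest_spec (P := fun T => 1 ≤ T ∧ NoiseCondition n k lam ε δ β T)
      (hM T₀ hT₀ hc₀) ⟨hT₀, hc₀⟩
  have hnot : ¬ NoiseCondition n k lam ε δ β (T + 1) := by
    intro hc'
    have h1 := hM (T + 1) (by omega) hc'
    exact Nat.findGreatest_is_greatest (P := fun T => 1 ≤ T ∧ NoiseCondition n k lam ε δ β T)
      (Nat.lt_succ_self T) h1 ⟨by omega, hc'⟩
  have hT' : (1 : ℝ) ≤ T := by exact_mod_cast hT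
  have hlog := log_le_add_abs_log (n := n) (k := k) (g := ceRate n k lam ε δ β) hT hg hβ hβ' (by
    have := hbound T hT hc
    rw [hge, ← hq2]
    calc (T : ℝ) * (8 * (K * k * q) ^ 2) = (K ^ 2 * 8 * k * T) * (k * q ^ 2) := by ring
      _ ≤ 1 * (k * q ^ 2) := by gcongr
      _ = _ := by ring)
  refine ⟨T, hT, hc, hlog, ?_⟩
  have hX2 : 2 ≤ Real.log (4 * n * k / β) := by
    have := two_le_log (four_le_mul (n := n) (k := k) le_rfl) hβ hβ'
    simpa using this
  have hLk : Real.log k ≤ Real.log (4 * n * k / β) := by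
    apply Real.log_le_log (by positivity)
    rw [le_div_iff₀ hβ]
    nlinarith
  set g := ceRate n k lam ε δ β
  set Λ := Real.log (4 * n * k / β) + |Real.log g| with hΛ
  have hΛ2 : 2 ≤ Λ := by linarith [abs_nonneg (Real.log g)]
  have hLk' : Real.log k ≤ Λ := by linarith [abs_nonneg (Real.log g)]
  have hL2 := two_le_log (four_le_mul (n := n) (k := k) hT) hβ hβ'
  -- Passing from `T` to `T + 1` at most squares the argument, so the logarithm at most doubles.
  have hlog1 : Real.log (4 * n * k * (T + 1 : ℕ) / β) ≤ 2 * (3 * Λ) := by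
    have h1 : 4 * n * k * ((T + 1 : ℕ) : ℝ) / β ≤ (4 * n * k * T / β) ^ 2 := by
      have h2 : 2 ≤ 4 * n * k * T / β := by
        rw [le_div_iff₀ hβ]; linarith [four_le_mul (n := n) (k := k) hT]
      calc 4 * n * k * ((T + 1 : ℕ) : ℝ) / β ≤ 4 * n * k * (2 * T) / β := by
            gcongr; push_cast; linarith
        _ = 2 * (4 * n * k * T / β) := by ring
        _ ≤ _ := by nlinarith
    have h3 := Real.log_le_log (by positivity) h1
    rw [Real.log_pow] at h3
    push_cast at h3 ⊢
    linarith
  have hL1 : 0 < Real.log (4 * n * k * (T + 1 : ℕ) / β) := by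
    have := two_le_log (four_le_mul (n := n) (k := k) (T := T + 1) (by omega)) hβ hβ'
    linarith
  have h1 : 1 < K * √8 * √k * (2 * √T) * (36 * Λ) := by
    rw [NoiseCondition, not_le, div_lt_iff₀ (by positivity), hbe] at hnot
    refine hnot.trans_le ?_
    have h2 : √((T + 1 : ℕ) : ℝ) ≤ 2 * √T := by
      rw [Real.sqrt_le_left (by positivity), mul_pow, Real.sq_sqrt (by positivity)]
      push_cast
      linarith
    have h3 : 6 * Real.log (4 * n * k * (T + 1 : ℕ) / β) ≤ 36 * Λ := by linarith
    gcongr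
  have hlk : √(Real.log k) ≤ Λ := by
    rw [Real.sqrt_le_left (by linarith)]
    nlinarith
  have hT0 : 0 < √(T : ℝ) := by positivity
  rw [Real.sqrt_div (mul_nonneg (by positivity) (Real.log_nonneg hk)),
    Real.sqrt_mul (by positivity), div_le_iff₀ hT0, hge]
  calc √k * √(Real.log k) = √k * √(Real.log k) * 1 := by ring
    _ ≤ √k * Λ * (K * √8 * √k * (2 * √T) * (36 * Λ)) := by gcongr
    _ = K * √k ^ 2 * (72 * √8) * Λ ^ 2 * √T := by ring
    _ ≤ K * √k ^ 2 * (72 * 3) * Λ ^ 2 * √T := by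
        have := sqrt_eight_le
        gcongr
    _ ≤ K * √k ^ 2 * (600 * q) * Λ ^ 2 * √T := by
        have : 72 * 3 ≤ 600 * q := by linarith
        gcongr
    _ = _ := by rw [hsk]; ring

theorem setOf_isApproxCE_mono {n k : ℕ} {Ω : Type*} {v : Fin n → Profile n k → ℝ}
    {w : Ω → Profile n k → ℝ} {η η' : ℝ} (h : η ≤ η') :
    {z | IsApproxCE v (w z) η} ⊆ {z | IsApproxCE v (w z) η'} :=
  fun z hz i f => (hz i f).le.trans' (by linarith)

theorem ceRate_nonneg {n k : ℕ} {lam ε δ β : ℝ} (hlam : 0 ≤ lam) (hε : 0 ≤ ε) :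
    0 ≤ ceRate n k lam ε δ β := by
  unfold ceRate; positivity

end NRLaplace

end

/-! ### Choice of the universal constants -/

theorem mainTheorem8 :
    ∃ (C : ℝ) (r : ℕ), 0 < C ∧
      -- every algorithm, every admissible number of rounds
      (∀ (n k : ℕ) [NeZero n] [NeZero k] (lam ε δ β : ℝ),
        0 < lam → 0 < ε → 0 < δ → δ < 1 → 0 < β → β ≤ 1 / 2 →
        ∀ T : ℕ, 1 ≤ T → NRLaplace.NoiseCondition n k lam ε δ β T →
        ∀ (A : NRLaplace.OnlineAlgorithm k) (R : ℝ), Measurable (Function.uncurry A) →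
          NRLaplace.HasSwapRegretAtMost A T R →
        ∀ (𝒯 : Fin n → Type*) (u : (i : Fin n) → 𝒯 i → NRLaplace.Profile n k → ℝ),
          NRLaplace.IsLarge u lam → (∀ i t a, 0 ≤ u i t a ∧ u i t a ≤ 1) →
        ∀ τ : (i : Fin n) → 𝒯 i,
          ENNReal.ofReal (1 - β) ≤
            NRLaplace.probApproxCE A.rescaled (fun i => u i (τ i)) T
              (NRLaplace.noiseScale n k lam ε δ T)
              (3 * R + C * NRLaplace.ceRate n k lam ε δ β *
                Real.log (4 * n * k * T / β) ^ r)) ∧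
      -- the no-swap-regret algorithm, a suitable number of rounds
      ∃ Aswap : (k T : ℕ) → NRLaplace.OnlineAlgorithm k,
        (∀ (k T : ℕ) [NeZero k], 1 ≤ T →
          Measurable (Function.uncurry (Aswap k T)) ∧
          NRLaplace.HasSwapRegretAtMost (Aswap k T) T (k * √(2 * Real.log k / T))) ∧
        ∀ (n k : ℕ) [NeZero n] [NeZero k] (lam ε δ β : ℝ),
          0 < lam → 0 < ε → 0 < δ → δ < 1 → 0 < β → β ≤ 1 / 2 →
          (∃ T₀ : ℕ, 1 ≤ T₀ ∧ NRLaplace.NoiseCondition n k lam ε δ β T₀) →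
          ∃ T : ℕ, 1 ≤ T ∧ NRLaplace.NoiseCondition n k lam ε δ β T ∧
            ∀ (𝒯 : Fin n → Type*) (u : (i : Fin n) → 𝒯 i → NRLaplace.Profile n k → ℝ),
              NRLaplace.IsLarge u lam → (∀ i t a, 0 ≤ u i t a ∧ u i t a ≤ 1) →
            ∀ τ : (i : Fin n) → 𝒯 i,
              ENNReal.ofReal (1 - β) ≤
                NRLaplace.probApproxCE (Aswap k T).rescaled (fun i => u i (τ i)) T
                  (NRLaplace.noiseScale n k lam ε δ T)
                  (C * NRLaplace.ceRate n k lam ε δ β *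
                    (Real.log (4 * n * k / β) +
                      |Real.log (NRLaplace.ceRate n k lam ε δ β)|) ^ r) := by
  -- `4500 = 3 * 2 * 600 + 100 * 3 ^ 2`: the regret term plus the noise term of the second part.
  refine ⟨4500, 2, by norm_num, ?_, NRLaplace.swapAlgorithm, ?_, ?_⟩
  · intro n k _ _ lam ε δ β hlam hε hδ hδ' hβ hβ' T hT hnc A R hA hR 𝒯 u _ hu τ
    refine (NRLaplace.le_probApproxCE_of_noiseCondition hlam hε hδ hδ' hβ hβ' hT hnc hA hR
      (v := fun i => u i (τ i)) fun i a => hu i (τ i) a).trans (measure_mono ?_)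
    refine NRLaplace.setOf_isApproxCE_mono ?_
    have hg := NRLaplace.ceRate_nonneg (n := n) (k := k) (δ := δ) (β := β) hlam.le hε.le
    gcongr
    norm_num
  · intro k T _ hT
    obtain ⟨hm, hR⟩ := NRLaplace.swapAlgorithm_spec k T hT
    exact ⟨hm, fun L hL => (hR L hL).trans NRLaplace.two_mul_sqrt_le⟩
  · intro n k _ _ lam ε δ β hlam hε hδ hδ' hβ hβ' h
    obtain ⟨T, hT, hnc, hlog, hsqrt⟩ := NRLaplace.exists_rounds hlam hε hδ hδ' hβ hβ' h
    refine ⟨T, hT, hnc, fun 𝒯 u _ hu τ => ?_⟩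
    -- The sharp regret bound is needed here: `k * √(2 * log k / T)` would cost an extra factor of
    -- order `√k` in the rate.
    obtain ⟨hm, hR⟩ := NRLaplace.swapAlgorithm_spec k T hT
    refine (NRLaplace.le_probApproxCE_of_noiseCondition hlam hε hδ hδ' hβ hβ' hT hnc hm hR
      (v := fun i => u i (τ i)) fun i a => hu i (τ i) a).trans (measure_mono ?_)
    refine NRLaplace.setOf_isApproxCE_mono ?_
    have hg := NRLaplace.ceRate_nonneg (n := n) (k := k) (δ := δ) (β := β) hlam.le hε.le
    have hL2 := NRLaplace.two_le_log (NRLaplace.four_le_mul (n := n) (k := k) hT) hβ hβ'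
    generalize NRLaplace.ceRate n k lam ε δ β = g at *
    generalize Real.log (4 * n * k / β) + |Real.log g| = Λ at *
    have h1 : Real.log (4 * n * k * T / β) ^ 2 ≤ (3 * Λ) ^ 2 := by gcongr
    have h2 := mul_le_mul_of_nonneg_left h1 (by positivity : 0 ≤ 100 * g)
    calc _ ≤ 3 * (2 * (600 * g * Λ ^ 2)) + 100 * g * (3 * Λ) ^ 2 := by gcongr
      _ = 4500 * g * Λ ^ 2 := by ring
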